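/- Let $(W,S)$ be a Coxeter system of finite rank with length function $\ell$. For $s\in S$ put $\alpha_s=\{w\in W : \ell(sw)>\ell(w)\}$; the root system is $\Phi=\{w\alpha_s : w\in W, s\in S\}$ (a set of subsets of $W$), $-\alpha$ denotes the complement $W\setminus\alpha$, a root is positive if it contains $1$, and $\Pi=\{\alpha_s : s\in S\}$ is the root basis. A pair of distinct roots $\{\alpha,\beta\}$ is prenilpotent if $\alpha\cap\beta$ and $(-\alpha)\cap(-\beta)$ are nonempty; then $]\alpha,\beta[$ is the set of roots $\gamma\neq\alpha,\beta$ with $\alpha\cap\beta\subset\gamma$ and $(-\alpha)\cap(-\beta)\subset-\gamma$. Let $G$ be a group endowed with a twin root datum $\{U_\alpha\}_{\alpha\in\Phi}$, i.e. a family of subgroups such that, with $T=\bigcap_{\alpha\in\Phi}N_G(U_\alpha)$ and with $U_+$ (resp. $U_-$) the subgroup generated by the $U_\alpha$ (resp. $U_{-\alpha}$) for $\alpha$ positive: - $U_\alpha\neq\{1\}$ for all $\alpha\in\Phi$; - $[U_\alpha,U_\beta]\subset\langle U_\gamma : \gamma\in\,]\alpha,\beta[\,\rangle$ for each prenilpotent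 pair $\{\alpha,\beta\}$ of distinct roots; - for each $\alpha=\alpha_s\in\Pi$ and $u\in U_\alpha\setminus\{1\}$ there are $u',u''\in U_{-\alpha}$ such that $m(u)=u'uu''$ conjugates $U_\beta$ onto $U_{s\beta}$ for each $\beta\in\Phi$; - $U_{-\alpha}\not\subset U_+$ and $U_\alpha\not\subset U_-$ for each $\alpha\in\Pi$; - $G=T\,\langle U_\alpha : \alpha\in\Phi\rangle$. Put $N=T\,\langle m(u) : u\in U_\alpha\setminus\{1\},\ \alpha\in\Pi\rangle$. Suppose that: 1. $(W,S)$ is irreducible, non-spherical ($W$ is infinite) and non-affine (its Tits form, with matrix $(-\cos(\pi/m_{st}))_{s,t\in S}$, is not positive semidefinite); 2. for each $\alpha\in\Pi$, the group $U_\alpha$ is nilpotent. Let $H$ be a normal subgroup of $G$ such that $N/T(N\cap H)$ is finite. Let $G^\dagger$ be the subgroup of $G$ generated by all the root groups, let $H^\dagger=H\cap G^\dagger$ and let $\pi:G^\dagger\to G^\dagger/H^\dagger$ be the canonical projection. Then the map $$\prod_{\alpha\in\Pi}U_\alpha\longrightarrow G^\dagger/H^\dagger,\qquad (u_\alpha)_{\alpha\in\Pi}\longmapsto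 \pi\Bigl(\prod_{\alpha\in\Pi}u_\alpha\Bigr)$$ (with the product in $G^\dagger$ taken in any order of $\Pi$, the result not depending on the order) is a surjective group homomorphism. In particular, $G^\dagger/H^\dagger$ is nilpotent. -/

import Mathlib

open scoped Pointwise

noncomputable section

namespace CoxeterSystem

variable {B W : Type*} [Group W] {M : CoxeterMatrix B}

/-- The half `{w ∈ W | ℓ(s w) > ℓ(w)}` of `W` containing `1`, attached to the canonical
generator `s = cs.simple i`. -/
def simpleHalf (cs : CoxeterSystem M W) (i : B) : Set W :=
  {w | cs.length w < cs.length (cs.simple i * w)}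

/-- A root of `(W, S)`: a left translate of one of the halves `simpleHalf`. -/
def IsRoot (cs : CoxeterSystem M W) (α : Set W) : Prop :=
  ∃ (w : W) (i : B), α = w • cs.simpleHalf i

/-- The combinatorial root system `Φ` of `(W, S)`. -/
def Root (cs : CoxeterSystem M W) : Type _ := {α : Set W // cs.IsRoot α}

theorem compl_simpleHalf (cs : CoxeterSystem M W) (i : B) :
    (cs.simpleHalf i)ᶜ = cs.simple i • cs.simpleHalf i := by
  ext w
  have hne := cs.length_simple_mul_ne w i
  simp only [simpleHalf, Set.mem_compl_iff, Set.mem_ofPred_eq, Set.mem_smul_set_iff_inv_smul_mem,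
    smul_eq_mul, cs.inv_simple, cs.simple_mul_simple_cancel_left]
  omega

theorem IsRoot.smul {cs : CoxeterSystem M W} {α : Set W} (h : cs.IsRoot α) (w : W) :
    cs.IsRoot (w • α) := by
  obtain ⟨v, i, rfl⟩ := h
  exact ⟨w * v, i, by rw [mul_smul]⟩

theorem IsRoot.compl {cs : CoxeterSystem M W} {α : Set W} (h : cs.IsRoot α) :
    cs.IsRoot αᶜ := by
  obtain ⟨v, i, rfl⟩ := h
  exact ⟨v * cs.simple i, i, by rw [← Set.smul_set_compl, compl_simpleHalf, mul_smul]⟩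

/-- The simple root `α_i`; the root basis `Π` is the family `(α_i)` indexed by `B`, i.e. by the
canonical generators. -/
def simpleRoot (cs : CoxeterSystem M W) (i : B) : cs.Root :=
  ⟨cs.simpleHalf i, 1, i, by rw [one_smul]⟩

namespace Root

variable {cs : CoxeterSystem M W}

/-- The opposite root `-α`. -/
def opp (α : cs.Root) : cs.Root := ⟨α.1ᶜ, α.2.compl⟩

/-- The action of `W` on roots by left translation. -/
def translate (w : W) (α : cs.Root) : cs.Root := ⟨w • α.1, α.2.smul w⟩

/-- A root is positive if it contains `1`. -/
def IsPos (α : cs.Root) : Prop := (1 : W) ∈ α.1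

/-- The pair `{α, β}` is prenilpotent: `α ∩ β` and `(-α) ∩ (-β)` are both nonempty. -/
def Prenilpotent (α β : cs.Root) : Prop :=
  (α.1 ∩ β.1).Nonempty ∧ (α.opp.1 ∩ β.opp.1).Nonempty

/-- The closed interval `[α, β]`. -/
def closedInterval (α β : cs.Root) : Set cs.Root :=
  {γ | α.1 ∩ β.1 ⊆ γ.1 ∧ α.opp.1 ∩ β.opp.1 ⊆ γ.opp.1}

/-- The open interval `]α, β[ = [α, β] \ {α, β}`. -/
def openInterval (α β : cs.Root) : Set cs.Root :=
  closedInterval α β \ {α, β}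

end Root

end CoxeterSystem

namespace CoxeterMatrix

variable {B : Type*} (M : CoxeterMatrix B)

/-- The Coxeter graph: distinct `i`, `j` are joined when `m(i, j) ≠ 2`. (The value `m(i, j) = 0`
encodes `m(i, j) = ∞`.) -/
def graph : SimpleGraph B where
  Adj i j := i ≠ j ∧ M i j ≠ 2
  symm := ⟨fun i j h => ⟨h.1.symm, by rw [M.symmetric]; exact h.2⟩⟩
  loopless := ⟨fun _ h => h.1 rfl⟩

/-- Irreducible type: the Coxeter graph is connected (in particular nonempty). -/
def IsIrreducible : Prop := M.graph.Connected

/-- The matrix of the Tits form: entries `-cos(π / m(i, j))`, and `-1` when `m(i, j) = ∞`. -/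
def titsMatrix : Matrix B B ℝ :=
  Matrix.of fun i j => if M i j = 0 then -1 else -Real.cos (Real.pi / (M i j : ℝ))

end CoxeterMatrix

namespace CoxeterSystem

variable {B W : Type*} [Group W] {M : CoxeterMatrix B}

/-- Spherical type: the Coxeter group is finite. -/
def IsSpherical (_cs : CoxeterSystem M W) : Prop := Finite W

/-- Affine type (for an irreducible system of finite rank): non-spherical with positive
semidefinite Tits form. -/
def IsAffine (cs : CoxeterSystem M W) : Prop :=
  ¬ cs.IsSpherical ∧ M.titsMatrix.PosSemidef

end CoxeterSystem

namespace RootGroups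

open CoxeterSystem

variable {B W : Type*} [Group W] {M : CoxeterMatrix B} {cs : CoxeterSystem M W}
  {G : Type*} [Group G] (U : cs.Root → Subgroup G)

/-- `T`, the intersection of the normalizers of the root groups. -/
def torus : Subgroup G := ⨅ α : cs.Root, Subgroup.normalizer (U α : Set G)

/-- `U₊`, generated by the root groups of positive roots. -/
def uPlus : Subgroup G := ⨆ (α : cs.Root) (_ : α.IsPos), U α

/-- `U₋`, generated by the root groups of opposites of positive roots. -/
def uMinus : Subgroup G := ⨆ (α : cs.Root) (_ : α.IsPos), U α.opp

/-- `G†`, generated by all the root groups. -/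
def dagger : Subgroup G := ⨆ α : cs.Root, U α

/-- `m` is an element of the form `m(u) = u' u u''` with `u', u''` in the root group of
`-α_i`, and it conjugates each `U_β` onto `U_{s_i(β)}`. -/
def IsWeylLift (i : B) (u m : G) : Prop :=
  (∃ u' ∈ U (cs.simpleRoot i).opp, ∃ u'' ∈ U (cs.simpleRoot i).opp, m = u' * u * u'') ∧
  ∀ β : cs.Root, (U β).map (MulAut.conj m).toMonoidHom = U (Root.translate (cs.simple i) β)

/-- `N = T.⟨m(u) | u ∈ U_α \ {1}, α ∈ Π⟩`. Two elements `m(u)`, `m(v)` attached to the same simple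
root differ by an element of `T`, so it does not matter which of them are used as generators. -/
def weylNormalizer : Subgroup G :=
  torus U ⊔ Subgroup.closure
    {m | ∃ (i : B) (u : G), u ∈ U (cs.simpleRoot i) ∧ u ≠ 1 ∧ IsWeylLift U i u m}

/-- The family `(U_α)`, indexed by the root system of `(W, S)`, is a twin root datum for `G`. -/
structure IsTwinRootDatum : Prop where
  ne_bot : ∀ α : cs.Root, U α ≠ ⊥
  commutator_le : ∀ α β : cs.Root, α ≠ β → α.Prenilpotent β →
    ⁅U α, U β⁆ ≤ ⨆ γ ∈ Root.openInterval α β, U γ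
  exists_weylLift : ∀ i : B, ∀ u ∈ U (cs.simpleRoot i), u ≠ 1 → ∃ m : G, IsWeylLift U i u m
  not_le_uPlus : ∀ i : B, ¬ U (cs.simpleRoot i).opp ≤ uPlus U
  not_le_uMinus : ∀ i : B, ¬ U (cs.simpleRoot i) ≤ uMinus U
  generates : torus U ⊔ dagger U = ⊤

/-- The inclusion `U_α → G†`. -/
def toDagger (α : cs.Root) : U α →* dagger U := Subgroup.inclusion (le_iSup U α)

/-- The canonical projection `G† → G† / (H ∩ G†)`. -/
def daggerProj (H : Subgroup G) [H.Normal] :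
    dagger U →* dagger U ⧸ H.subgroupOf (dagger U) :=
  QuotientGroup.mk' (H.subgroupOf (dagger U))

end RootGroups

end

/-! Let W' be the group of those w in W induced by elements of N ∩ H. It is normal of finite index
in W, and for w in W' the groups U_{wα} and U_α have the same image modulo H. For each simple root α
there is w in W' such that neither of α, wα contains the other (`exists_not_nested`). Then {α, -wα}
is prenilpotent, so U_α and U_{-wα} lie in a common nilpotent group
(`IsTwinRootDatum.exists_isNilpotent`). Modulo H, the images of U_α and U_{-α} therefore generate a
nilpotent group, which contains the image of an element m(u) conjugating one to the other. Subgroups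
that generate a nilpotent group and are conjugate in it coincide (`Subgroup.eq_of_map_conj_eq`), so
U_α and U_{-α} have the same image.

For distinct simple roots the pair {-α_i, α_j} is prenilpotent with empty open interval, so U_{-α_i}
and U_{α_j} commute; modulo H, U_{α_i} and U_{α_j} then commute too. The images of the simple root
groups contain those of lifts of the simple reflections, hence generate the image of G†.

The existence of w is proved with the geometric representation, where nested halves have root
vectors of Tits product at least 1. If α_i and wα_i were nested for all w in W', then B(e_i, w e_i)
≥ 1 throughout W'. When some value exceeds 1, the roots project so rigidly to a hyperbolic plane
that the rank is at most two and the form is semidefinite. When all values equal 1, a finite sum of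
squares over W/W' is a W-invariant form, proportional to the Tits form by irreducibility. Both cases
contradict the non-affine hypothesis. -/

noncomputable section

/-! ### The Tits form and its reflections. -/

namespace CoxeterMatrix

variable {B : Type*} (M : CoxeterMatrix B)

theorem titsMatrix_self (i : B) : M.titsMatrix i i = 1 := by
  simp [titsMatrix]

theorem titsMatrix_comm (i j : B) : M.titsMatrix i j = M.titsMatrix j i := by
  simp [titsMatrix, M.symmetric i j]

theorem two_le_of_ne {i j : B} (h : i ≠ j) (h0 : M i j ≠ 0) : 2 ≤ M i j := by
  have := M.off_diagonal i j h
  omega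

theorem titsMatrix_of_ne_zero {i j : B} (h0 : M i j ≠ 0) :
    M.titsMatrix i j = -Real.cos (Real.pi / (M i j : ℝ)) := by
  simp [titsMatrix, h0]

theorem neg_one_le_titsMatrix (i j : B) : -1 ≤ M.titsMatrix i j := by
  by_cases h0 : M i j = 0
  · simp [titsMatrix, h0]
  · rw [M.titsMatrix_of_ne_zero h0]
    linarith [Real.cos_le_one (Real.pi / (M i j : ℝ))]

theorem pi_div_mem {i j : B} (h : i ≠ j) (h0 : M i j ≠ 0) :
    0 < Real.pi / (M i j : ℝ) ∧ Real.pi / (M i j : ℝ) ≤ Real.pi / 2 := by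
  have h2 : (2 : ℝ) ≤ (M i j : ℝ) := by exact_mod_cast M.two_le_of_ne h h0
  have := Real.pi_pos
  exact ⟨by positivity, by gcongr⟩

theorem sin_pi_div_pos {i j : B} (h : i ≠ j) (h0 : M i j ≠ 0) :
    0 < Real.sin (Real.pi / (M i j : ℝ)) := by
  obtain ⟨h1, h2⟩ := M.pi_div_mem h h0
  exact Real.sin_pos_of_pos_of_lt_pi h1 (by linarith [Real.pi_pos])

theorem titsMatrix_nonpos {i j : B} (h : i ≠ j) : M.titsMatrix i j ≤ 0 := by
  by_cases h0 : M i j = 0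
  · simp [titsMatrix, h0]
  · obtain ⟨h1, h2⟩ := M.pi_div_mem h h0
    rw [M.titsMatrix_of_ne_zero h0, neg_nonpos]
    exact Real.cos_nonneg_of_mem_Icc ⟨by linarith [Real.pi_pos], h2⟩

theorem titsMatrix_ne_zero_of_adj {i j : B} (h : M.graph.Adj i j) : M.titsMatrix i j ≠ 0 := by
  by_cases h0 : M i j = 0
  · simp [titsMatrix, h0]
  · have h3 : (2 : ℝ) < (M i j : ℝ) := by
      have := M.two_le_of_ne h.1 h0
      have := h.2
      exact_mod_cast (by omega : 2 < M i j)
    rw [M.titsMatrix_of_ne_zero h0, neg_ne_zero]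
    refine (Real.cos_pos_of_mem_Ioo ⟨?_, ?_⟩).ne'
    · linarith [Real.pi_pos, (M.pi_div_mem h.1 h0).1]
    · have := Real.pi_pos
      gcongr

/-- The sequence `0, 1, 2 k, 4 k ^ 2 - 1, …` of values of Chebyshev polynomials of the second
kind. -/
def chebSeq (k : ℝ) : ℕ → ℝ
  | 0 => 0
  | 1 => 1
  | n + 2 => 2 * k * chebSeq k (n + 1) - chebSeq k n

theorem chebSeq_succ_succ (k : ℝ) (n : ℕ) :
    chebSeq k (n + 2) = 2 * k * chebSeq k (n + 1) - chebSeq k n := rfl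

theorem chebSeq_one (n : ℕ) : chebSeq 1 n = n ∧ chebSeq 1 (n + 1) = n + 1 := by
  induction n with
  | zero => simp [chebSeq]
  | succ n ih =>
    refine ⟨by exact_mod_cast ih.2, ?_⟩
    rw [chebSeq_succ_succ, ih.1, ih.2]
    push_cast
    ring

/-- Two consecutive indices are carried together because the recurrence has order two. -/
theorem sin_mul_chebSeq (θ : ℝ) (n : ℕ) :
    Real.sin θ * chebSeq (Real.cos θ) n = Real.sin (n * θ) ∧
      Real.sin θ * chebSeq (Real.cos θ) (n + 1) = Real.sin ((n + 1) * θ) := by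
  induction n with
  | zero => simp [chebSeq]
  | succ n ih =>
    refine ⟨by exact_mod_cast ih.2, ?_⟩
    rw [chebSeq_succ_succ, mul_sub, ih.1, mul_left_comm, ih.2]
    have h1 : ((n : ℝ) * θ) = (n + 1) * θ - θ := by ring
    have h2 : (((n + 1 : ℕ) : ℝ) + 1) * θ = (n + 1) * θ + θ := by push_cast; ring
    rw [h1, h2, Real.sin_sub, Real.sin_add]
    ring

/-- With θ = π / m the value is sin(nθ) / sin θ, and nθ stays in [0, π] up to n = m; for m = ∞ it is
n. -/
theorem chebSeq_nonneg {i j : B} (h : i ≠ j) {n : ℕ} (hn : M i j ≠ 0 → n ≤ M i j) :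
    0 ≤ chebSeq (-M.titsMatrix i j) n := by
  by_cases h0 : M i j = 0
  · have : -M.titsMatrix i j = 1 := by simp [titsMatrix, h0]
    rw [this, (chebSeq_one n).1]
    positivity
  · rw [M.titsMatrix_of_ne_zero h0, neg_neg]
    have h1 := M.sin_pi_div_pos h h0
    have h2 := (sin_mul_chebSeq (Real.pi / (M i j : ℝ)) n).1
    have hm : (0 : ℝ) < M i j := by exact_mod_cast Nat.pos_of_ne_zero h0
    have h3 : 0 ≤ Real.sin (n * (Real.pi / (M i j : ℝ))) := by
      refine Real.sin_nonneg_of_nonneg_of_le_pi (by have := Real.pi_pos; positivity) ?_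
      have h4 : (n : ℝ) ≤ M i j := by exact_mod_cast hn h0
      calc n * (Real.pi / (M i j : ℝ)) ≤ M i j * (Real.pi / (M i j : ℝ)) := by
            have := Real.pi_pos
            gcongr
        _ = Real.pi := by field_simp
    rw [← h2] at h3
    exact nonneg_of_mul_nonneg_right h3 h1

variable [Fintype B] [DecidableEq B]

/-- The Tits form as a bilinear form. -/
def titsForm : LinearMap.BilinForm ℝ (B → ℝ) := Matrix.toBilin' M.titsMatrix

variable (B) in
/-- The basis vector attached to a canonical generator. -/
abbrev simpleVec (i : B) : B → ℝ := Pi.single i 1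

theorem titsForm_simpleVec (i j : B) :
    M.titsForm (simpleVec B i) (simpleVec B j) = M.titsMatrix i j := by
  simp [titsForm, simpleVec, Matrix.toBilin'_single]

theorem titsForm_simpleVec_self (i : B) : M.titsForm (simpleVec B i) (simpleVec B i) = 1 := by
  rw [titsForm_simpleVec, titsMatrix_self]

theorem titsForm_comm (x y : B → ℝ) : M.titsForm x y = M.titsForm y x := by
  simp only [titsForm, Matrix.toBilin'_apply]
  rw [Finset.sum_comm]
  refine Finset.sum_congr rfl fun i _ => Finset.sum_congr rfl fun j _ => ?_
  rw [M.titsMatrix_comm]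
  ring

/-- The reflection in a vector of norm one. -/
def refl (a : B → ℝ) : Module.End ℝ (B → ℝ) :=
  LinearMap.id - ((2 : ℝ) • M.titsForm a).smulRight a

theorem refl_apply (a x : B → ℝ) : M.refl a x = x - (2 * M.titsForm a x) • a := by
  simp [refl]

theorem refl_mul_self {a : B → ℝ} (ha : M.titsForm a a = 1) : M.refl a * M.refl a = 1 := by
  refine LinearMap.ext fun x => ?_
  rw [Module.End.mul_apply, refl_apply, refl_apply, map_sub, map_smul, ha]
  simp only [Module.End.one_apply, smul_eq_mul]
  module

theorem titsForm_refl {a : B → ℝ} (ha : M.titsForm a a = 1) (x y : B → ℝ) :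
    M.titsForm (M.refl a x) (M.refl a y) = M.titsForm x y := by
  simp [refl_apply, ha, M.titsForm_comm x a]
  ring

theorem refl_simpleVec_self (i : B) : M.refl (simpleVec B i) (simpleVec B i) = -simpleVec B i := by
  rw [refl_apply, titsForm_simpleVec_self]
  module

theorem refl_simpleVec (i j : B) : M.refl (simpleVec B i) (simpleVec B j) =
    simpleVec B j + (2 * -M.titsMatrix i j) • simpleVec B i := by
  rw [refl_apply, titsForm_simpleVec]
  module

theorem refl_mul_refl_pow_apply (i j : B) (n : ℕ) :
    ((M.refl (simpleVec B i) * M.refl (simpleVec B j)) ^ n) (simpleVec B i) =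
      chebSeq (-M.titsMatrix i j) (2 * n + 1) • simpleVec B i +
        chebSeq (-M.titsMatrix i j) (2 * n) • simpleVec B j := by
  induction n with
  | zero => simp [chebSeq]
  | succ n ih =>
    rw [pow_succ', Module.End.mul_apply, ih, Module.End.mul_apply]
    simp only [map_add, map_smul, refl_simpleVec, M.titsMatrix_comm j i, titsMatrix_self,
      show 2 * (n + 1) = 2 * n + 2 by ring, chebSeq_succ_succ]
    module

theorem refl_mul_refl_pow_simpleVec {i j : B} (h : i ≠ j) (h0 : M i j ≠ 0) :
    ((M.refl (simpleVec B i) * M.refl (simpleVec B j)) ^ M i j) (simpleVec B i) =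
      simpleVec B i := by
  have h1 := M.sin_pi_div_pos h h0
  have hm : (M i j : ℝ) ≠ 0 := by exact_mod_cast h0
  have hc := sin_mul_chebSeq (Real.pi / (M i j : ℝ)) (2 * M i j)
  have e1 : ((2 * M i j : ℕ) : ℝ) * (Real.pi / (M i j : ℝ)) = 2 * Real.pi := by
    push_cast
    field_simp
  have e2 : (((2 * M i j : ℕ) : ℝ) + 1) * (Real.pi / (M i j : ℝ)) =
      Real.pi / (M i j : ℝ) + 2 * Real.pi := by
    rw [add_mul, e1]
    ring
  rw [e1, e2, Real.sin_two_pi, Real.sin_add_two_pi] at hc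
  have c0 := (mul_eq_zero.1 hc.1).resolve_left h1.ne'
  have c1 := mul_left_cancel₀ h1.ne' (hc.2.trans (mul_one _).symm)
  rw [refl_mul_refl_pow_apply, M.titsMatrix_of_ne_zero h0, neg_neg, c0, c1]
  simp

theorem pow_mul_swap_pow_eq_one {R : Type*} [Monoid R] {a b : R} (ha : a * a = 1) (hb : b * b = 1)
    (n : ℕ) : (a * b) ^ n * (b * a) ^ n = 1 := by
  induction n with
  | zero => simp
  | succ n ih =>
    rw [pow_succ, pow_succ', mul_assoc, ← mul_assoc (a * b) (b * a), mul_assoc a b (b * a),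
      ← mul_assoc b b a, hb, one_mul, ha, one_mul, ih]

/-- For finite m and i ≠ j, the form is nondegenerate on the plane of the two basis vectors. The
power fixes that plane by the sine formula, and both reflections fix its orthogonal. -/
theorem isLiftable_refl : M.IsLiftable fun i => M.refl (simpleVec B i) := by
  intro i j
  by_cases h0 : M i j = 0
  · rw [h0, pow_zero]
  by_cases h : i = j
  · subst h
    rw [M.refl_mul_self (M.titsForm_simpleVec_self i), one_pow]
  set σi := M.refl (simpleVec B i) with hσi
  set σj := M.refl (simpleVec B j) with hσj
  have hi : ((σi * σj) ^ M i j) (simpleVec B i) = simpleVec B i :=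
    M.refl_mul_refl_pow_simpleVec h h0
  have hj : ((σi * σj) ^ M i j) (simpleVec B j) = simpleVec B j := by
    have h1 := M.refl_mul_refl_pow_simpleVec (Ne.symm h) (by rwa [M.symmetric])
    rw [M.symmetric j i] at h1
    conv_lhs => rw [← h1]
    rw [← Module.End.mul_apply, pow_mul_swap_pow_eq_one
      (M.refl_mul_self (M.titsForm_simpleVec_self i))
      (M.refl_mul_self (M.titsForm_simpleVec_self j))]
    rfl
  have hk : 1 - M.titsMatrix i j ^ 2 ≠ 0 := by
    rw [M.titsMatrix_of_ne_zero h0, neg_sq]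
    have := Real.sin_sq_add_cos_sq (Real.pi / (M i j : ℝ))
    have := M.sin_pi_div_pos h h0
    nlinarith
  refine LinearMap.ext fun x => ?_
  change ((σi * σj) ^ M i j) x = x
  set c := M.titsMatrix i j with hc
  set u := M.titsForm (simpleVec B i) x with hu
  set v := M.titsForm (simpleVec B j) x with hv
  -- The orthogonal projection of `x` to the plane, by Cramer's rule for the Gram matrix with
  -- off-diagonal entry `c`.
  set p : B → ℝ := ((u - c * v) / (1 - c ^ 2)) • simpleVec B i +
    ((v - c * u) / (1 - c ^ 2)) • simpleVec B j with hp
  have hpi : M.titsForm (simpleVec B i) p = u := by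
    rw [hp]
    simp only [map_add, map_smul, titsForm_simpleVec, titsMatrix_self, smul_eq_mul, ← hc]
    field_simp
    ring
  have hpj : M.titsForm (simpleVec B j) p = v := by
    rw [hp]
    simp only [map_add, map_smul, titsForm_simpleVec, titsMatrix_self, smul_eq_mul,
      M.titsMatrix_comm j i, ← hc]
    field_simp
    ring
  have hfix : ∀ n : ℕ, ((σi * σj) ^ n) (x - p) = x - p := by
    intro n
    have hi0 : σi (x - p) = x - p := by
      rw [hσi, refl_apply, map_sub, ← hu, hpi, sub_self, mul_zero, zero_smul, sub_zero]
    have hj0 : σj (x - p) = x - p := by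
      rw [hσj, refl_apply, map_sub, ← hv, hpj, sub_self, mul_zero, zero_smul, sub_zero]
    induction n with
    | zero => rfl
    | succ n ih => rw [pow_succ', Module.End.mul_apply, ih, Module.End.mul_apply, hj0, hi0]
  have hp' : ((σi * σj) ^ M i j) p = p := by
    rw [hp, map_add, map_smul, map_smul, hi, hj]
  calc ((σi * σj) ^ M i j) x = ((σi * σj) ^ M i j) ((x - p) + p) := by rw [sub_add_cancel]
    _ = x := by rw [map_add, hfix, hp', sub_add_cancel]

end CoxeterMatrix

/-! ### The geometric representation and the sign of root vectors. -/

namespace CoxeterSystem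

open CoxeterMatrix

variable {B W : Type*} [Fintype B] [DecidableEq B] [Group W] {M : CoxeterMatrix B}
  (cs : CoxeterSystem M W)

/-- The geometric representation. -/
def geomRep : W →* Module.End ℝ (B → ℝ) := cs.lift ⟨_, M.isLiftable_refl⟩

theorem geomRep_simple (i : B) : cs.geomRep (cs.simple i) = M.refl (simpleVec B i) :=
  cs.lift_apply_simple _ i

theorem geomRep_mul_apply (v w : W) (x : B → ℝ) :
    cs.geomRep (v * w) x = cs.geomRep v (cs.geomRep w x) := by
  rw [map_mul, Module.End.mul_apply]

theorem geomRep_one_apply (x : B → ℝ) : cs.geomRep 1 x = x := by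
  rw [map_one, Module.End.one_apply]

theorem geomRep_inv_apply_apply (w : W) (x : B → ℝ) :
    cs.geomRep w⁻¹ (cs.geomRep w x) = x := by
  rw [← geomRep_mul_apply, inv_mul_cancel, geomRep_one_apply]

theorem geomRep_apply_inv_apply (w : W) (x : B → ℝ) :
    cs.geomRep w (cs.geomRep w⁻¹ x) = x := by
  rw [← geomRep_mul_apply, mul_inv_cancel, geomRep_one_apply]

theorem titsForm_geomRep (w : W) (x y : B → ℝ) :
    M.titsForm (cs.geomRep w x) (cs.geomRep w y) = M.titsForm x y := by
  induction w using cs.simple_induction_left with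
  | one => simp only [geomRep_one_apply]
  | mul_simple_left w i ih =>
    rw [geomRep_mul_apply, geomRep_mul_apply, geomRep_simple,
      M.titsForm_refl (M.titsForm_simpleVec_self i), ih]

theorem titsForm_geomRep_left (w : W) (x y : B → ℝ) :
    M.titsForm (cs.geomRep w x) y = M.titsForm x (cs.geomRep w⁻¹ y) := by
  rw [← cs.titsForm_geomRep w x, geomRep_apply_inv_apply]

theorem geomRep_conj_simple (w : W) (i : B) (x : B → ℝ) :
    cs.geomRep (w * cs.simple i * w⁻¹) x = M.refl (cs.geomRep w (simpleVec B i)) x := by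
  rw [geomRep_mul_apply, geomRep_mul_apply, geomRep_simple, refl_apply, refl_apply, map_sub,
    map_smul, geomRep_apply_inv_apply, titsForm_geomRep_left]

theorem geomRep_simpleVec_ne_zero (w : W) (i : B) : cs.geomRep w (simpleVec B i) ≠ 0 := by
  intro h
  have h1 := cs.titsForm_geomRep w (simpleVec B i) (simpleVec B i)
  rw [h, M.titsForm_simpleVec_self] at h1
  simp at h1

theorem geomRep_alternatingWord (i j : B) (n : ℕ) :
    cs.geomRep (cs.wordProd (alternatingWord i j n)) (simpleVec B i) =
      chebSeq (-M.titsMatrix i j) (n + 1) • simpleVec B (if Even n then i else j) +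
        chebSeq (-M.titsMatrix i j) n • simpleVec B (if Even n then j else i) := by
  induction n with
  | zero => simp [alternatingWord, chebSeq]
  | succ n ih =>
    rw [alternatingWord_succ', wordProd_cons, geomRep_mul_apply, ih, geomRep_simple]
    by_cases hn : Even n
    · have hn' : ¬ Even (n + 1) := by simpa [Nat.even_add_one] using hn
      simp only [hn, hn', if_true, if_false, map_add, map_smul, refl_simpleVec, titsMatrix_self,
        M.titsMatrix_comm j i, chebSeq_succ_succ]
      module
    · have hn' : Even (n + 1) := by simpa [Nat.even_add_one] using hn
      simp only [hn, hn', if_true, if_false, map_add, map_smul, refl_simpleVec, titsMatrix_self,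
        chebSeq_succ_succ]
      module

/-- Split off from `w` the longest possible alternating suffix in `i`, `j`. The remaining factor `v`
is shorter and has neither letter as right descent, so induction applies to both basis vectors. The
suffix sends `e_i` to a combination of them with Chebyshev coefficients, nonnegative because its
length is less than m(i, j). -/
theorem geomRep_simpleVec_nonneg {w : W} {i : B} (h : ¬ cs.IsRightDescent w i) :
    0 ≤ cs.geomRep w (simpleVec B i) := by
  induction hl : cs.length w using Nat.strong_induction_on generalizing w i with
  | _ l ih =>
  subst hl
  by_cases hw : w = 1
  · subst hw
    rw [geomRep_one_apply]
    exact Pi.single_nonneg.2 zero_le_one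
  obtain ⟨j, hj⟩ := cs.exists_rightDescent_of_ne_one hw
  have hij : i ≠ j := by
    rintro rfl
    exact h hj
  -- the decompositions of `w` with an alternating word in `i`, `j` on the right
  let Q : ℕ → Prop := fun n => ∃ v : W, w = v * cs.wordProd (alternatingWord i j n) ∧
    cs.length w = cs.length v + n
  have hQ1 : Q 1 := by
    refine ⟨w * cs.simple j, ?_, ?_⟩
    · simp [alternatingWord]
    · rw [cs.isRightDescent_iff] at hj
      exact hj.symm
  have hQb : ∀ n, Q n → n ≤ cs.length w := by
    rintro n ⟨v, -, hv⟩
    omega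
  classical
  set n := Nat.findGreatest Q (cs.length w) with hn
  have hQn : Q n := Nat.findGreatest_spec (hQb 1 hQ1) hQ1
  have hn1 : 1 ≤ n := Nat.le_findGreatest (hQb 1 hQ1) hQ1
  have hQn1 : ¬ Q (n + 1) := by
    intro hq
    have := Nat.le_findGreatest (hQb _ hq) hq
    omega
  obtain ⟨v, hwv, hlv⟩ := hQn
  have hnM : M i j ≠ 0 → n + 1 ≤ M i j := by
    intro h0
    by_contra hlt
    apply h
    -- otherwise the braid relation turns the last letter into `i`
    obtain ⟨r, hr⟩ : ∃ r, n = r + M i j := ⟨n - M i j, by omega⟩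
    have hsplit : ∀ r : ℕ, ∃ ω : List B, ω.length = r ∧
        cs.wordProd (alternatingWord i j (r + M i j)) =
          cs.wordProd ω * cs.wordProd (alternatingWord j i (M i j)) := by
      intro r
      induction r with
      | zero =>
        refine ⟨[], rfl, ?_⟩
        have := cs.wordProd_braidWord_eq i j
        rw [braidWord, braidWord, M.symmetric j i] at this
        rw [zero_add, this, wordProd_nil, one_mul]
      | succ r ih' =>
        obtain ⟨ω, hω, he⟩ := ih'
        refine ⟨(if Even (r + M i j) then j else i) :: ω, by simp [hω], ?_⟩
        rw [show r + 1 + M i j = r + M i j + 1 by omega, alternatingWord_succ', wordProd_cons,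
          wordProd_cons, he, mul_assoc]
    obtain ⟨ω, hω, he⟩ := hsplit r
    obtain ⟨m, hm⟩ : ∃ m, M i j = m + 1 := ⟨M i j - 1, by omega⟩
    have hwi : w * cs.simple i = v * (cs.wordProd ω * cs.wordProd (alternatingWord i j m)) := by
      rw [hwv, hr, he, hm, alternatingWord_succ, wordProd_concat]
      simp only [mul_assoc, simple_mul_simple_self, mul_one]
    have h1 := cs.length_mul_le v (cs.wordProd ω * cs.wordProd (alternatingWord i j m))
    have h2 := cs.length_mul_le (cs.wordProd ω) (cs.wordProd (alternatingWord i j m))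
    have h3 := cs.length_wordProd_le ω
    have h4 := cs.length_wordProd_le (alternatingWord i j m)
    rw [length_alternatingWord] at h4
    rw [IsRightDescent, hwi]
    omega
  have hv_next : ¬ cs.IsRightDescent v (if Even n then j else i) := by
    intro hd
    refine hQn1 ⟨v * cs.simple (if Even n then j else i), ?_, ?_⟩
    · rw [alternatingWord_succ', wordProd_cons, mul_assoc, simple_mul_simple_cancel_left, hwv]
    · rw [cs.isRightDescent_iff] at hd
      omega
  have hv_prev : ¬ cs.IsRightDescent v (if Even n then i else j) := by
    intro hd
    obtain ⟨m, hm⟩ : ∃ m, n = m + 1 := ⟨n - 1, by omega⟩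
    have hpar : (if Even n then i else j) = (if Even m then j else i) := by
      rw [hm]
      by_cases he : Even m <;> simp [Nat.even_add_one, he]
    rw [hpar, cs.isRightDescent_iff] at hd
    have hw' : w = (v * cs.simple (if Even m then j else i)) *
        cs.wordProd (alternatingWord i j m) := by
      rw [hwv, hm, alternatingWord_succ', wordProd_cons, mul_assoc]
    have h1 := cs.length_mul_le (v * cs.simple (if Even m then j else i))
      (cs.wordProd (alternatingWord i j m))
    have h4 := cs.length_wordProd_le (alternatingWord i j m)
    rw [length_alternatingWord] at h4
    rw [← hw'] at h1
    omega
  have hlt : cs.length v < cs.length w := by omega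
  have p1 := ih _ hlt hv_next rfl
  have p2 := ih _ hlt hv_prev rfl
  rw [hwv, geomRep_mul_apply, geomRep_alternatingWord, map_add, map_smul, map_smul]
  exact add_nonneg (smul_nonneg (M.chebSeq_nonneg hij hnM) p2)
    (smul_nonneg (M.chebSeq_nonneg hij fun h0 => (Nat.le_succ n).trans (hnM h0)) p1)

theorem geomRep_simpleVec_nonpos {w : W} {i : B} (h : cs.IsRightDescent w i) :
    cs.geomRep w (simpleVec B i) ≤ 0 := by
  have h1 := cs.geomRep_simpleVec_nonneg (cs.isRightDescent_iff_not_isRightDescent_mul.1 h)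
  rw [geomRep_mul_apply, geomRep_simple, refl_simpleVec_self, map_neg] at h1
  exact neg_nonneg.1 h1

theorem geomRep_simpleVec_nonneg_iff {w : W} {i : B} :
    0 ≤ cs.geomRep w (simpleVec B i) ↔ ¬ cs.IsRightDescent w i :=
  ⟨fun h hd => cs.geomRep_simpleVec_ne_zero w i (le_antisymm (cs.geomRep_simpleVec_nonpos hd) h),
    cs.geomRep_simpleVec_nonneg⟩

theorem geomRep_simpleVec_nonneg_or_nonpos (w : W) (i : B) :
    0 ≤ cs.geomRep w (simpleVec B i) ∨ cs.geomRep w (simpleVec B i) ≤ 0 := by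
  by_cases h : cs.IsRightDescent w i
  · exact Or.inr (cs.geomRep_simpleVec_nonpos h)
  · exact Or.inl (cs.geomRep_simpleVec_nonneg h)

/-- The dictionary between combinatorial roots and root vectors. -/
theorem mem_smul_simpleHalf_iff {x w : W} {i : B} :
    x ∈ w • cs.simpleHalf i ↔ 0 ≤ cs.geomRep (x⁻¹ * w) (simpleVec B i) := by
  rw [geomRep_simpleVec_nonneg_iff, Set.mem_smul_set_iff_inv_smul_mem, smul_eq_mul, simpleHalf,
    ← cs.isLeftDescent_inv_iff, mul_inv_rev, inv_inv, IsLeftDescent, Set.mem_ofPred_eq]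
  have := cs.length_simple_mul_ne (w⁻¹ * x) i
  omega

end CoxeterSystem

/-! ### Nested roots have Tits product at least one. -/

theorem eq_zero_of_nonneg_of_linear_recurrence {f : ℕ → ℝ} {β : ℝ} (hβ : β < 1)
    -- The second difference is -2(1 - β) f(n + 1) ≤ 0. A nonnegative concave sequence is
    -- nondecreasing, so the increments drop by at least 2(1 - β) f(1) each time, which forces f(1)
    -- = 0.
    (hf : ∀ n, 0 ≤ f n) (hr : ∀ n, f (n + 2) = 2 * β * f (n + 1) - f n) : f 1 = 0 := by
  have hd : ∀ n, f (n + 2) - f (n + 1) ≤ f (n + 1) - f n := by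
    intro n
    nlinarith [hf (n + 1), hr n]
  have hdm : ∀ N m, f (N + m + 1) - f (N + m) ≤ f (N + 1) - f N := by
    intro N m
    induction m with
    | zero => exact le_rfl
    | succ m ih => exact (hd (N + m)).trans ih
  have hmono : ∀ N, f N ≤ f (N + 1) := by
    intro N
    by_contra hlt
    have hlin : ∀ m : ℕ, f (N + m) ≤ f N + m * (f (N + 1) - f N) := by
      intro m
      induction m with
      | zero => simp
      | succ m ih =>
        have := hdm N m
        rw [← add_assoc]
        push_cast
        linarith
    obtain ⟨m, hm⟩ := exists_nat_gt (f N / (f N - f (N + 1)))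
    rw [div_lt_iff₀ (by linarith)] at hm
    nlinarith [hlin m, hf (N + m)]
  have hge : ∀ n, f 1 ≤ f (n + 1) := by
    intro n
    induction n with
    | zero => exact le_rfl
    | succ n ih => exact ih.trans (hmono _)
  have hlin : ∀ n : ℕ, f (n + 1) - f n ≤ f 1 - f 0 - n * (2 * (1 - β) * f 1) := by
    intro n
    induction n with
    | zero => simp
    | succ n ih =>
      push_cast
      nlinarith [hr n, hge n]
  by_contra h0
  have h1 : 0 < f 1 := lt_of_le_of_ne (hf 1) (Ne.symm h0)
  have h2 : 0 < 2 * (1 - β) * f 1 := by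
    have : 0 < 1 - β := by linarith
    positivity
  obtain ⟨n, hn⟩ := exists_nat_gt ((f 1 - f 0) / (2 * (1 - β) * f 1))
  rw [div_lt_iff₀ h2] at hn
  linarith [hlin n, hmono n]

namespace CoxeterSystem

open CoxeterMatrix

variable {B W : Type*} [Fintype B] [DecidableEq B] [Group W] {M : CoxeterMatrix B}
  (cs : CoxeterSystem M W)

/-- The vectors in the orbits of the basis vectors under the geometric representation. -/
def IsRootVec (b : B → ℝ) : Prop := ∃ (x : W) (j : B), b = cs.geomRep x (simpleVec B j)

variable {cs}

theorem isRootVec_simpleVec (j : B) : cs.IsRootVec (simpleVec B j) :=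
  ⟨1, j, by rw [geomRep_one_apply]⟩

theorem IsRootVec.geomRep {b : B → ℝ} (hb : cs.IsRootVec b) (w : W) :
    cs.IsRootVec (cs.geomRep w b) := by
  obtain ⟨x, j, rfl⟩ := hb
  exact ⟨w * x, j, by rw [geomRep_mul_apply]⟩

theorem IsRootVec.exists_reflection {b : B → ℝ} (hb : cs.IsRootVec b) :
    ∃ r : W, ∀ x, cs.geomRep r x = M.refl b x := by
  obtain ⟨x, j, rfl⟩ := hb
  exact ⟨_, cs.geomRep_conj_simple x j⟩

theorem IsRootVec.refl {b c : B → ℝ} (hb : cs.IsRootVec b) (hc : cs.IsRootVec c) :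
    cs.IsRootVec (M.refl c b) := by
  obtain ⟨r, hr⟩ := hc.exists_reflection
  rw [← hr]
  exact hb.geomRep r

theorem IsRootVec.titsForm_self {b : B → ℝ} (hb : cs.IsRootVec b) : M.titsForm b b = 1 := by
  obtain ⟨x, j, rfl⟩ := hb
  rw [titsForm_geomRep, titsForm_simpleVec_self]

theorem IsRootVec.ne_zero {b : B → ℝ} (hb : cs.IsRootVec b) : b ≠ 0 := by
  obtain ⟨x, j, rfl⟩ := hb
  exact cs.geomRep_simpleVec_ne_zero x j

theorem IsRootVec.nonneg_or_nonpos {b : B → ℝ} (hb : cs.IsRootVec b) : 0 ≤ b ∨ b ≤ 0 := by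
  obtain ⟨x, j, rfl⟩ := hb
  exact cs.geomRep_simpleVec_nonneg_or_nonpos x j

/-- Reflecting in `x b` makes `b` negative, hence also `a` by nestedness; reflecting in the new
image of `a` makes `a` positive again. This advances the sequence of images of `a`, `b` by two
terms. -/
theorem IsRootVec.nonneg_step {a b : B → ℝ} (ha : cs.IsRootVec a) (hb : cs.IsRootVec b)
    (h : ∀ x : W, 0 ≤ cs.geomRep x a → 0 ≤ cs.geomRep x b) {x : W}
    (hx : 0 ≤ cs.geomRep x b) :
    ∃ y : W, cs.geomRep y a = (2 * M.titsForm a b) • cs.geomRep x b - cs.geomRep x a ∧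
      cs.geomRep y b = (2 * M.titsForm a b) • cs.geomRep y a - cs.geomRep x b ∧
      0 ≤ cs.geomRep y a := by
  obtain ⟨r, hr⟩ := (hb.geomRep x).exists_reflection
  have hra : cs.geomRep (r * x) a = cs.geomRep x a - (2 * M.titsForm a b) • cs.geomRep x b := by
    rw [geomRep_mul_apply, hr, refl_apply, titsForm_geomRep, M.titsForm_comm b a]
  have hrb : cs.geomRep (r * x) b = -cs.geomRep x b := by
    rw [geomRep_mul_apply, hr, refl_apply, titsForm_geomRep, hb.titsForm_self]
    module
  have hneg : cs.geomRep (r * x) a ≤ 0 := by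
    refine (ha.geomRep (r * x)).nonneg_or_nonpos.resolve_left fun h0 => ?_
    have h1 := h _ h0
    rw [hrb, neg_nonneg] at h1
    exact (hb.geomRep x).ne_zero (le_antisymm h1 hx)
  obtain ⟨r', hr'⟩ := (ha.geomRep (r * x)).exists_reflection
  have hya : cs.geomRep (r' * (r * x)) a = -cs.geomRep (r * x) a := by
    rw [geomRep_mul_apply, hr', refl_apply, titsForm_geomRep, ha.titsForm_self]
    module
  refine ⟨r' * (r * x), ?_, ?_, ?_⟩
  · rw [hya, hra]
    module
  · rw [hya, geomRep_mul_apply, hr', refl_apply, titsForm_geomRep, hrb]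
    module
  · rw [hya]
    exact neg_nonneg.2 hneg

theorem IsRootVec.one_le_titsForm {a b : B → ℝ} (ha : cs.IsRootVec a) (hb : cs.IsRootVec b)
    (h : ∀ x : W, 0 ≤ cs.geomRep x a → 0 ≤ cs.geomRep x b) : 1 ≤ M.titsForm a b := by
  by_contra! hlt
  obtain ⟨x₀, hx₀⟩ : ∃ x : W, 0 ≤ cs.geomRep x a := by
    obtain ⟨u, i, rfl⟩ := ha
    refine ⟨u⁻¹, ?_⟩
    rw [geomRep_inv_apply_apply]
    exact Pi.single_nonneg.2 zero_le_one
  set β := M.titsForm a b with hβ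
  -- Consecutive terms of the recurrence with coefficient `2 * β`. Even indices give pairs (x a, x
  -- b), so every term is a nonnegative vector and the recurrence lemma applies to each coordinate.
  let g : ℕ → (B → ℝ) × (B → ℝ) := fun n =>
    Nat.rec (cs.geomRep x₀ a, cs.geomRep x₀ b) (fun _ p => (p.2, (2 * β) • p.2 - p.1)) n
  have hg : ∀ n, g (n + 1) = ((g n).2, (2 * β) • (g n).2 - (g n).1) := fun n => rfl
  have hg2 : ∀ n, g (2 * (n + 1)) = ((2 * β) • (g (2 * n)).2 - (g (2 * n)).1,
      (2 * β) • ((2 * β) • (g (2 * n)).2 - (g (2 * n)).1) - (g (2 * n)).2) := fun n => rfl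
  have hinv : ∀ n, ∃ x : W, cs.geomRep x a = (g (2 * n)).1 ∧ cs.geomRep x b = (g (2 * n)).2 ∧
      0 ≤ cs.geomRep x a := by
    intro n
    induction n with
    | zero => exact ⟨x₀, rfl, rfl, hx₀⟩
    | succ n ih =>
      obtain ⟨x, h1, h2, h3⟩ := ih
      obtain ⟨y, k1, k2, k3⟩ := ha.nonneg_step hb h (h x h3)
      refine ⟨y, ?_, ?_, k3⟩
      · rw [k1, h1, h2, hg2]
      · rw [k2, k1, h1, h2, hg2]
  have hnn : ∀ n, 0 ≤ (g n).1 := by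
    intro n
    obtain ⟨m, rfl | rfl⟩ := n.even_or_odd'
    · obtain ⟨x, h1, -, h3⟩ := hinv m
      rwa [← h1]
    · obtain ⟨x, -, h2, h3⟩ := hinv m
      rw [hg, ← h2]
      exact h x h3
  refine (hb.geomRep x₀).ne_zero (funext fun l => ?_)
  exact eq_zero_of_nonneg_of_linear_recurrence (f := fun n => (g n).1 l) hlt (fun n => hnn n l)
    (fun n => by simp [hg])

theorem one_le_titsForm_of_subset {u v : W} {i j : B}
    (h : u • cs.simpleHalf i ⊆ v • cs.simpleHalf j) :
    1 ≤ M.titsForm (cs.geomRep u (simpleVec B i)) (cs.geomRep v (simpleVec B j)) := by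
  refine ((isRootVec_simpleVec i).geomRep u).one_le_titsForm
    ((isRootVec_simpleVec j).geomRep v) fun x hx => ?_
  rw [← geomRep_mul_apply] at hx ⊢
  have := @h x⁻¹ (cs.mem_smul_simpleHalf_iff.2 (by rwa [inv_inv]))
  rw [mem_smul_simpleHalf_iff, inv_inv] at this
  exact this

/-! ### Finite-index normal subgroups with all products at least one. -/

section Positive

variable {W' : Subgroup W} {i : B}

/-- The product of the reflections in `e_i` and `w e_i` is a commutator lying in `W'`; the
hypothesis `hW` for its conjugate by `u⁻¹` is exactly this inequality. -/
theorem discriminant_nonpos [W'.Normal]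
    (hW : ∀ w ∈ W', 1 ≤ M.titsForm (simpleVec B i) (cs.geomRep w (simpleVec B i)))
    {w : W} (hw : w ∈ W') (u : W) {k c d : ℝ}
    (hk : M.titsForm (simpleVec B i) (cs.geomRep w (simpleVec B i)) = k)
    (hc : M.titsForm (simpleVec B i) (cs.geomRep u (simpleVec B i)) = c)
    (hd : M.titsForm (cs.geomRep w (simpleVec B i)) (cs.geomRep u (simpleVec B i)) = d) :
    c ^ 2 - 2 * k * c * d + d ^ 2 ≤ 0 := by
  have ht : u⁻¹ * (cs.simple i * (w * cs.simple i * w⁻¹)) * u ∈ W' := by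
    have h1 : cs.simple i * w * (cs.simple i)⁻¹ * w⁻¹ ∈ W' :=
      W'.mul_mem (Subgroup.Normal.conj_mem ‹_› w hw _) (W'.inv_mem hw)
    have h2 := Subgroup.Normal.conj_mem ‹W'.Normal› _ h1 u⁻¹
    rw [inv_simple, inv_inv] at h2
    simpa only [mul_assoc] using h2
  have h1 := hW _ ht
  rw [geomRep_mul_apply, geomRep_mul_apply, ← cs.titsForm_geomRep_left, geomRep_mul_apply,
    geomRep_conj_simple, ← cs.inv_simple, ← cs.titsForm_geomRep_left, geomRep_simple,
    refl_apply, refl_apply, hc, hd] at h1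
  have h3 : M.titsForm (cs.geomRep u (simpleVec B i)) (cs.geomRep u (simpleVec B i)) = 1 := by
    rw [titsForm_geomRep, titsForm_simpleVec_self]
  simp only [map_sub, map_smul, LinearMap.sub_apply, LinearMap.smul_apply, smul_eq_mul, h3, hc, hk,
    M.titsForm_comm (cs.geomRep u (simpleVec B i)) (cs.geomRep w (simpleVec B i)), hd] at h1
  linarith

variable {w : W} {k : ℝ}

/-- The previous inequality with `u` the reflection in `b`. -/
theorem discriminant_le_of_isRootVec [W'.Normal]
    (hW : ∀ w ∈ W', 1 ≤ M.titsForm (simpleVec B i) (cs.geomRep w (simpleVec B i)))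
    (hw : w ∈ W') (hk : M.titsForm (simpleVec B i) (cs.geomRep w (simpleVec B i)) = k)
    {b : B → ℝ} (hb : cs.IsRootVec b) {c d : ℝ} (hc : M.titsForm (simpleVec B i) b = c)
    (hd : M.titsForm (cs.geomRep w (simpleVec B i)) b = d) :
    (k ^ 2 - 1) * (4 * c ^ 2 - 1) + 4 * c ^ 2 * (c ^ 2 - 2 * k * c * d + d ^ 2) ≤ 0 := by
  obtain ⟨r, hr⟩ := hb.exists_reflection
  have e : cs.geomRep r (simpleVec B i) = simpleVec B i - (2 * c) • b := by
    rw [hr, refl_apply, M.titsForm_comm b, hc]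
  have h := discriminant_nonpos hW hw r (k := k) (c := 1 - 2 * c ^ 2) (d := k - 2 * c * d) hk
    (by rw [e, map_sub, map_smul, hc, titsForm_simpleVec_self, smul_eq_mul]; ring)
    (by rw [e, map_sub, map_smul, hd, M.titsForm_comm _ (simpleVec B i), hk, smul_eq_mul])
  linarith

/-- Outside the orthogonal of the hyperbolic plane spanned by `e_i` and its image, a root has
projection to that plane of norm at least one. -/
theorem orthogonal_or_discriminant_le [W'.Normal]
    (hW : ∀ w ∈ W', 1 ≤ M.titsForm (simpleVec B i) (cs.geomRep w (simpleVec B i)))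
    (hw : w ∈ W') (hk : M.titsForm (simpleVec B i) (cs.geomRep w (simpleVec B i)) = k)
    (hk1 : 1 < k) {b : B → ℝ} (hb : cs.IsRootVec b) {c d : ℝ}
    (hc : M.titsForm (simpleVec B i) b = c)
    (hd : M.titsForm (cs.geomRep w (simpleVec B i)) b = d) :
    (c = 0 ∧ d = 0) ∨ c ^ 2 - 2 * k * c * d + d ^ 2 ≤ -(k ^ 2 - 1) := by
  by_contra! hcon
  obtain ⟨hcd, hF⟩ := hcon
  set a := simpleVec B i with ha
  set a' := cs.geomRep w a with ha'
  have haR : cs.IsRootVec a := isRootVec_simpleVec i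
  have ha'R : cs.IsRootVec a' := haR.geomRep w
  set F := c ^ 2 - 2 * k * c * d + d ^ 2 with hFdef
  set E := k ^ 2 - 1 + F with hE
  have hE0 : 0 < E := by linarith
  set K := (k ^ 2 - 1) / (4 * E) + 1 with hK
  have hkk : 0 < k ^ 2 - 1 := by nlinarith
  have hK1 : 1 ≤ K := by
    have : 0 ≤ (k ^ 2 - 1) / (4 * E) := by positivity
    linarith
  set q := 2 * k ^ 2 - 1 with hq
  have hq1 : 1 < q := by nlinarith
  have key : ∀ n : ℕ, ∀ b : B → ℝ, cs.IsRootVec b → ∀ c d : ℝ, M.titsForm a b = c →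
      M.titsForm a' b = d → c ^ 2 - 2 * k * c * d + d ^ 2 = F → |c| * q ^ n ≤ K := by
    intro n
    induction n with
    | zero =>
      intro b hb c d hc hd hF'
      have h1 := discriminant_le_of_isRootVec hW hw hk hb hc hd
      rw [hF'] at h1
      have h2 : c ^ 2 ≤ (k ^ 2 - 1) / (4 * E) := by
        rw [le_div_iff₀ (by positivity), hE]
        linarith
      rw [pow_zero, mul_one]
      have h3 : |c| ^ 2 ≤ K := by rw [sq_abs]; linarith
      nlinarith [abs_nonneg c]
    | succ n ih =>
      intro b hb c d hc hd hF'
      have hka : M.titsForm a' a = k := by rw [M.titsForm_comm, hk]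
      have e1 : M.titsForm a (M.refl a' b) = c - 2 * k * d := by
        rw [refl_apply, map_sub, map_smul, hc, hd, hk, smul_eq_mul]; ring
      have e2 : M.titsForm a' (M.refl a' b) = -d := by
        rw [refl_apply, map_sub, map_smul, hd, ha'R.titsForm_self, smul_eq_mul]; ring
      have e3 : M.titsForm a (M.refl a b) = -c := by
        rw [refl_apply, map_sub, map_smul, hc, haR.titsForm_self, smul_eq_mul]; ring
      have e4 : M.titsForm a' (M.refl a b) = d - 2 * k * c := by
        rw [refl_apply, map_sub, map_smul, hc, hd, hka, smul_eq_mul]; ring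
      have e5 : M.titsForm a (M.refl a' (M.refl a b)) = (4 * k ^ 2 - 1) * c - 2 * k * d := by
        rw [refl_apply, map_sub, map_smul, e3, e4, hk, smul_eq_mul]; ring
      have e6 : M.titsForm a' (M.refl a' (M.refl a b)) = 2 * k * c - d := by
        rw [refl_apply, map_sub, map_smul, e4, ha'R.titsForm_self, smul_eq_mul]; ring
      have h1 := ih _ (hb.refl ha'R) _ _ e1 e2 (by rw [← hF']; ring)
      have h2 := ih _ ((hb.refl haR).refl ha'R) _ _ e5 e6 (by rw [← hF']; ring)
      have hqn : 0 < q ^ n := by positivity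
      -- 2qc is the difference of the `c`-values of two other roots of the orbit, to which the
      -- induction hypothesis applies.
      have h3 : |2 * q * c| ≤ |(4 * k ^ 2 - 1) * c - 2 * k * d| + |c - 2 * k * d| := by
        refine le_trans (le_of_eq ?_) (abs_sub _ _)
        congr 1
        rw [hq]
        ring
      rw [abs_mul, abs_of_pos (by linarith : (0 : ℝ) < 2 * q)] at h3
      have h4 := mul_le_mul_of_nonneg_right h3 hqn.le
      rw [pow_succ]
      nlinarith
  have hzero : ∀ b : B → ℝ, cs.IsRootVec b → ∀ c d : ℝ, M.titsForm a b = c →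
      M.titsForm a' b = d → c ^ 2 - 2 * k * c * d + d ^ 2 = F → c = 0 := by
    intro b hb c d hc hd hF'
    by_contra h0
    have hc0 : 0 < |c| := abs_pos.2 h0
    obtain ⟨n, hn⟩ := pow_unbounded_of_one_lt (K / |c|) hq1
    rw [div_lt_iff₀ hc0] at hn
    linarith [key n b hb c d hc hd hF']
  have hc0 := hzero b hb c d hc hd rfl
  have e1 : M.titsForm a (M.refl a' b) = c - 2 * k * d := by
    rw [refl_apply, map_sub, map_smul, hc, hd, hk, smul_eq_mul]; ring
  have e2 : M.titsForm a' (M.refl a' b) = -d := by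
    rw [refl_apply, map_sub, map_smul, hd, ha'R.titsForm_self, smul_eq_mul]; ring
  have h1 := hzero _ (hb.refl ha'R) _ _ e1 e2 (by rw [hFdef]; ring)
  refine hcd hc0 ?_
  rw [hc0, zero_sub, neg_eq_zero] at h1
  exact (mul_eq_zero.1 h1).resolve_left (by positivity)

/-- The second case says that `e_j` has the same projection to the plane as `-e_i`. It follows from
-1 ≤ c ≤ 0 by completing the square. -/
theorem simpleVec_dichotomy [W'.Normal]
    (hW : ∀ w ∈ W', 1 ≤ M.titsForm (simpleVec B i) (cs.geomRep w (simpleVec B i)))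
    (hw : w ∈ W') (hk : M.titsForm (simpleVec B i) (cs.geomRep w (simpleVec B i)) = k)
    (hk1 : 1 < k) {j : B} (hj : i ≠ j) :
    (M.titsMatrix i j = 0 ∧ M.titsForm (cs.geomRep w (simpleVec B i)) (simpleVec B j) = 0) ∨
      (M.titsMatrix i j = -1 ∧
        M.titsForm (cs.geomRep w (simpleVec B i)) (simpleVec B j) = -k) := by
  set d := M.titsForm (cs.geomRep w (simpleVec B i)) (simpleVec B j) with hd
  obtain h | h := orthogonal_or_discriminant_le hW hw hk hk1 (isRootVec_simpleVec j)
    (M.titsForm_simpleVec i j) hd.symm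
  · exact Or.inl h
  · right
    set c := M.titsMatrix i j with hc
    have h0 : c ≤ 0 := M.titsMatrix_nonpos hj
    have h1 : -1 ≤ c := M.neg_one_le_titsMatrix i j
    have hkk : 0 < k ^ 2 - 1 := by nlinarith
    have hc2 : c ^ 2 ≤ 1 := by nlinarith
    have hsq : (d - k * c) ^ 2 ≤ (k ^ 2 - 1) * (c ^ 2 - 1) := by nlinarith
    have hc1 : c = -1 := by
      by_contra hne
      have : -1 < c := lt_of_le_of_ne h1 (Ne.symm hne)
      have : c ^ 2 < 1 := by nlinarith
      nlinarith [sq_nonneg (d - k * c)]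
    refine ⟨hc1, ?_⟩
    rw [hc1] at hsq
    have : (d - k * -1) ^ 2 = 0 := le_antisymm (by linarith) (sq_nonneg _)
    have := pow_eq_zero_iff (two_ne_zero) |>.1 this
    linarith

/-- Otherwise, reflecting `b₂` in the image of `b₁` under the two plane reflections gives a root
whose projection is neither zero nor of norm at least one. The bounds `2 < k` and `-2 ≤ B(b₁, b₂)`
only fix signs. -/
theorem one_le_titsForm_of_same_projection [W'.Normal]
    (hW : ∀ w ∈ W', 1 ≤ M.titsForm (simpleVec B i) (cs.geomRep w (simpleVec B i)))
    (hw : w ∈ W') (hk : M.titsForm (simpleVec B i) (cs.geomRep w (simpleVec B i)) = k)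
    (hk1 : 2 < k) {b₁ b₂ : B → ℝ} (hb₁ : cs.IsRootVec b₁) (hb₂ : cs.IsRootVec b₂)
    (hc₁ : M.titsForm (simpleVec B i) b₁ = -1)
    (hd₁ : M.titsForm (cs.geomRep w (simpleVec B i)) b₁ = -k)
    (hc₂ : M.titsForm (simpleVec B i) b₂ = -1)
    (hd₂ : M.titsForm (cs.geomRep w (simpleVec B i)) b₂ = -k)
    (hlow : -2 ≤ M.titsForm b₁ b₂) : 1 ≤ M.titsForm b₁ b₂ := by
  by_contra! hlt
  set a := simpleVec B i with ha
  set a' := cs.geomRep w a with ha'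
  have haR : cs.IsRootVec a := isRootVec_simpleVec i
  have ha'R : cs.IsRootVec a' := haR.geomRep w
  have hka : M.titsForm a' a = k := by rw [M.titsForm_comm, hk]
  have e1 : M.refl a b₁ = b₁ + (2 : ℝ) • a := by
    rw [refl_apply, hc₁]; module
  have e2 : M.refl a' (M.refl a b₁) = b₁ + (2 : ℝ) • a - (2 * k) • a' := by
    rw [refl_apply, e1, map_add, map_smul, hd₁, hka, smul_eq_mul]; module
  set x := M.titsForm b₁ b₂ with hx
  have hb : cs.IsRootVec (M.refl a' (M.refl a b₁)) := (hb₁.refl haR).refl ha'R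
  set β := M.refl a' (M.refl a b₁) with hβ
  have f1 : M.titsForm β b₂ = x - 2 + 2 * k ^ 2 := by
    rw [e2]
    simp only [map_add, map_sub, map_smul, LinearMap.add_apply, LinearMap.sub_apply,
      LinearMap.smul_apply, smul_eq_mul, hc₂, hd₂, ← hx]
    ring
  have f2 : M.titsForm a β = 1 - 2 * k ^ 2 := by
    rw [e2]
    simp only [map_add, map_sub, map_smul, smul_eq_mul, hc₁, hk, haR.titsForm_self]
    ring
  have f3 : M.titsForm a' β = -k := by
    rw [e2]
    simp only [map_add, map_sub, map_smul, smul_eq_mul, hd₁, hka, ha'R.titsForm_self]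
    ring
  have g1 : M.titsForm a (M.refl β b₂) = -1 - 2 * (x - 2 + 2 * k ^ 2) * (1 - 2 * k ^ 2) := by
    rw [refl_apply, map_sub, map_smul, f1, f2, hc₂, smul_eq_mul]
  have g2 : M.titsForm a' (M.refl β b₂) = -k + 2 * (x - 2 + 2 * k ^ 2) * k := by
    rw [refl_apply, map_sub, map_smul, f1, f3, hd₂, smul_eq_mul]; ring
  have hk4 : 4 < k ^ 2 := by nlinarith
  obtain ⟨-, h⟩ | h :=
    orthogonal_or_discriminant_le hW hw hk (by linarith) (hb₂.refl hb) g1 g2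
  · have h' : k * (2 * (x - 2 + 2 * k ^ 2) - 1) = 0 := by linarith
    rcases mul_eq_zero.1 h' with h' | h' <;> linarith
  · have h' : (k ^ 2 - 1) * (4 * (x - 2 + 2 * k ^ 2) * (x - 1)) ≥ 0 := by linarith
    have h1 : 0 < k ^ 2 - 1 := by linarith
    have h2 : 0 < x - 2 + 2 * k ^ 2 := by linarith
    have h3 : (k ^ 2 - 1) * (4 * (x - 2 + 2 * k ^ 2) * (1 - x)) > 0 := by
      have : 0 < 1 - x := by linarith
      positivity
    linarith

/-- Replacing `w` by its commutator with the simple reflection turns k into 2k² - 1, which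
multiplies k - 1 by at least 4. -/
theorem exists_two_lt_titsForm [W'.Normal]
    (hw : w ∈ W') (hk1 : 1 < M.titsForm (simpleVec B i) (cs.geomRep w (simpleVec B i))) :
    ∃ w ∈ W', 2 < M.titsForm (simpleVec B i) (cs.geomRep w (simpleVec B i)) := by
  set δ := M.titsForm (simpleVec B i) (cs.geomRep w (simpleVec B i)) - 1 with hδ
  have hδ0 : 0 < δ := by linarith
  have key : ∀ n : ℕ, ∃ w ∈ W',
      1 + 4 ^ n * δ ≤ M.titsForm (simpleVec B i) (cs.geomRep w (simpleVec B i)) := by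
    intro n
    induction n with
    | zero => exact ⟨w, hw, by rw [hδ]; simp⟩
    | succ n ih =>
      obtain ⟨v, hv, hvn⟩ := ih
      set k := M.titsForm (simpleVec B i) (cs.geomRep v (simpleVec B i)) with hk
      have h1 : cs.simple i * v * (cs.simple i)⁻¹ * v⁻¹ ∈ W' :=
        W'.mul_mem (Subgroup.Normal.conj_mem ‹_› v hv _) (W'.inv_mem hv)
      refine ⟨_, h1, ?_⟩
      have e : cs.simple i * v * (cs.simple i)⁻¹ * v⁻¹ =
          (cs.simple i)⁻¹ * (v * cs.simple i * v⁻¹) := by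
        rw [inv_simple]; simp only [mul_assoc]
      rw [e, geomRep_mul_apply, ← titsForm_geomRep_left, geomRep_conj_simple, geomRep_simple,
        refl_simpleVec_self, refl_apply, M.titsForm_comm _ (simpleVec B i), ← hk]
      simp only [map_neg, LinearMap.neg_apply, map_sub, map_smul, smul_eq_mul,
        titsForm_simpleVec_self, ← hk]
      have : 0 < (4 : ℝ) ^ n * δ := by positivity
      rw [pow_succ]
      nlinarith
  obtain ⟨n, hn⟩ := pow_unbounded_of_one_lt (1 / δ) (by norm_num : (1 : ℝ) < 4)
  rw [div_lt_iff₀ hδ0] at hn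
  obtain ⟨v, hv, hvn⟩ := key n
  exact ⟨v, hv, by linarith⟩

theorem _root_.SimpleGraph.Connected.forall_of_adj {V : Type*} {Γ : SimpleGraph V}
    (h : Γ.Connected) {p : V → Prop} {a : V} (ha : p a) (hp : ∀ b c, p b → Γ.Adj b c → p c)
    (b : V) : p b := by
  obtain ⟨q⟩ := h.preconnected a b
  induction q with
  | nil => exact ha
  | cons hadj _ ih => exact ih (hp _ _ ha hadj)

theorem posSemidef_of_hyperbolic [W'.Normal] (hirr : M.IsIrreducible)
    (hW : ∀ w ∈ W', 1 ≤ M.titsForm (simpleVec B i) (cs.geomRep w (simpleVec B i)))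
    (hw : w ∈ W') (hk1 : 1 < M.titsForm (simpleVec B i) (cs.geomRep w (simpleVec B i))) :
    M.titsMatrix.PosSemidef := by
  obtain ⟨v, hv, hk⟩ := exists_two_lt_titsForm hw hk1
  have dich := fun j (hj : i ≠ j) => simpleVec_dichotomy hW hv rfl (by linarith) hj
  have same := fun b₁ b₂ => one_le_titsForm_of_same_projection hW hv rfl hk (b₁ := b₁) (b₂ := b₂)
  -- If `l` were orthogonal to `i` but adjacent to a neighbour `j` of `i`, then `e_j` and its
  -- reflection in `e_l` would have the same projection and product 1 - 2B(e_j, e_l)² < 1.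
  have nbr : ∀ j, i = j ∨ M.titsMatrix i j = -1 := by
    refine hirr.forall_of_adj (Or.inl rfl) fun j l hj hadj => ?_
    by_cases hil : i = l
    · exact Or.inl hil
    right
    obtain ⟨hl, hl'⟩ | ⟨hl, -⟩ := dich l hil
    swap
    · exact hl
    exfalso
    have hjl := M.titsMatrix_ne_zero_of_adj hadj
    rcases hj with rfl | hj
    · exact hjl hl
    have hij : i ≠ j := by
      rintro rfl
      rw [titsMatrix_self] at hj
      norm_num at hj
    obtain ⟨h1, -⟩ | ⟨-, hj'⟩ := dich j hij
    · rw [h1] at hj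
      norm_num at hj
    have e : M.refl (simpleVec B l) (simpleVec B j) =
        simpleVec B j - (2 * M.titsMatrix l j) • simpleVec B l := by
      rw [refl_apply, titsForm_simpleVec]
    have f : M.titsForm (simpleVec B j) (M.refl (simpleVec B l) (simpleVec B j)) =
        1 - 2 * M.titsMatrix j l ^ 2 := by
      rw [e, map_sub, map_smul, titsForm_simpleVec, titsForm_simpleVec, titsMatrix_self,
        M.titsMatrix_comm l j, smul_eq_mul]
      ring
    have hb1 := M.neg_one_le_titsMatrix j l
    have hb2 := M.titsMatrix_nonpos hadj.1
    have h3 := same (simpleVec B j) (M.refl (simpleVec B l) (simpleVec B j))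
      (isRootVec_simpleVec j) ((isRootVec_simpleVec j).refl (isRootVec_simpleVec l))
      (by rw [titsForm_simpleVec, hj]) hj'
      (by rw [e, map_sub, map_smul, titsForm_simpleVec, titsForm_simpleVec, hl, hj, smul_zero,
        sub_zero])
      (by rw [e, map_sub, map_smul, hl', hj', smul_zero, sub_zero]) (by rw [f]; nlinarith)
    rw [f] at h3
    have : 0 < M.titsMatrix j l ^ 2 := by positivity
    linarith
  -- Two distinct neighbours would have product at least 1, yet off-diagonal entries are
  -- nonpositive.
  have uniq : ∀ j l, i ≠ j → i ≠ l → j = l := by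
    intro j l hj hl
    by_contra hjl
    have hj1 := (nbr j).resolve_left hj
    have hl1 := (nbr l).resolve_left hl
    obtain ⟨h1, -⟩ | ⟨-, hj'⟩ := dich j hj
    · rw [h1] at hj1; norm_num at hj1
    obtain ⟨h1, -⟩ | ⟨-, hl'⟩ := dich l hl
    · rw [h1] at hl1; norm_num at hl1
    have h3 := same (simpleVec B j) (simpleVec B l) (isRootVec_simpleVec j) (isRootVec_simpleVec l)
      (by rw [titsForm_simpleVec, hj1]) hj' (by rw [titsForm_simpleVec, hl1]) hl'
      (by rw [titsForm_simpleVec]; linarith [M.neg_one_le_titsMatrix j l])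
    rw [titsForm_simpleVec] at h3
    linarith [M.titsMatrix_nonpos hjl]
  have : M.titsMatrix = Matrix.vecMulVec (fun j => if i = j then (1 : ℝ) else -1)
      (star fun j => if i = j then (1 : ℝ) else -1) := by
    ext j l
    simp only [Matrix.vecMulVec_apply, star_trivial]
    by_cases hj : i = j <;> by_cases hl : i = l
    · subst hj; subst hl; simp [titsMatrix_self]
    · subst hj; simp [hl, (nbr l).resolve_left hl]
    · subst hl; rw [M.titsMatrix_comm]; simp [hj, (nbr j).resolve_left hj]
    · obtain rfl := uniq j l hj hl
      simp [hj, titsMatrix_self]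
  rw [this]
  exact Matrix.posSemidef_vecMulVec_self_star _

/-- For k = 1 the discriminant is (d - c)², so `w e_i - e_i` is orthogonal to the orbit of `e_i`.
Connectedness spreads this to the orbits of all basis vectors. -/
theorem titsForm_geomRep_eq_of_parabolic [W'.Normal] (hirr : M.IsIrreducible)
    (hW : ∀ w ∈ W', M.titsForm (simpleVec B i) (cs.geomRep w (simpleVec B i)) = 1)
    (hw : w ∈ W') : M.titsForm (cs.geomRep w (simpleVec B i)) = M.titsForm (simpleVec B i) := by
  have key : ∀ j, ∀ u : W, M.titsForm (cs.geomRep w (simpleVec B i) - simpleVec B i)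
      (cs.geomRep u (simpleVec B j)) = 0 := by
    refine hirr.forall_of_adj (a := i) ?_ ?_
    · intro u
      have h := discriminant_nonpos (fun w hw => (hW w hw).ge) hw u (hW w hw) rfl rfl
      set c := M.titsForm (simpleVec B i) (cs.geomRep u (simpleVec B i))
      set d := M.titsForm (cs.geomRep w (simpleVec B i)) (cs.geomRep u (simpleVec B i)) with hd
      have h2 : (d - c) ^ 2 = 0 := le_antisymm (by linarith) (sq_nonneg _)
      rw [map_sub, LinearMap.sub_apply]
      exact pow_eq_zero_iff (two_ne_zero) |>.1 h2
    · intro j l hj hadj u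
      have h1 := hj (u * cs.simple l)
      rw [geomRep_mul_apply, geomRep_simple, refl_simpleVec, map_add, map_smul, map_add, hj,
        map_smul, zero_add, smul_eq_mul] at h1
      refine (mul_eq_zero.1 h1).resolve_left ?_
      rw [M.titsMatrix_comm l j]
      simpa using M.titsMatrix_ne_zero_of_adj hadj
  refine (Pi.basisFun ℝ B).ext fun j => ?_
  have h1 := key j 1
  rw [geomRep_one_apply, map_sub, LinearMap.sub_apply, sub_eq_zero] at h1
  simpa using h1

theorem posSemidef_of_parabolic [W'.Normal] [W'.FiniteIndex] (hirr : M.IsIrreducible)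
    (hW : ∀ w ∈ W', M.titsForm (simpleVec B i) (cs.geomRep w (simpleVec B i)) = 1) :
    M.titsMatrix.PosSemidef := by
  have : Fintype (W ⧸ W') := Fintype.ofFinite _
  let Q : W ⧸ W' → ((B → ℝ) →ₗ[ℝ] ℝ) := fun q => M.titsForm (cs.geomRep q.out (simpleVec B i))
  have hQ : ∀ u : W, Q (u : W ⧸ W') = M.titsForm (cs.geomRep u (simpleVec B i)) := by
    intro u
    obtain ⟨⟨h, hh⟩, hu⟩ := QuotientGroup.mk_out_eq_mul W' u
    refine LinearMap.ext fun x => ?_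
    change M.titsForm (cs.geomRep ((u : W ⧸ W').out) (simpleVec B i)) x = _
    rw [hu, geomRep_mul_apply, cs.titsForm_geomRep_left u, cs.titsForm_geomRep_left u,
      titsForm_geomRep_eq_of_parabolic hirr hW hh]
  -- A sum of squares, invariant because W permutes the cosets.
  let E : (B → ℝ) → ((B → ℝ) →ₗ[ℝ] ℝ) := fun y => ∑ q, Q q y • Q q
  have hE : ∀ x y, E y x = ∑ q, Q q y * Q q x := by
    intro x y
    simp [E]
  have hEcomm : ∀ x y, E y x = E x y := by
    intro x y
    simp only [hE, mul_comm]
  have hinv : ∀ (g : W) (x y), E (cs.geomRep g y) (cs.geomRep g x) = E y x := by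
    intro g x y
    have hQg : ∀ q z, Q (g • q) (cs.geomRep g z) = Q q z := by
      intro q z
      induction q using QuotientGroup.induction_on with
      | H u =>
        rw [MulAction.Quotient.smul_coe, smul_eq_mul, hQ, hQ, geomRep_mul_apply, titsForm_geomRep]
    rw [hE, hE, ← Equiv.sum_comp (MulAction.toPerm g)]
    refine Finset.sum_congr rfl fun q _ => ?_
    rw [MulAction.toPerm_apply, hQg, hQg]
  -- An invariant form is determined against `e_j` up to a scalar, since the reflection negates
  -- `e_j`; symmetry of `E` then equates the scalars at adjacent vertices.
  have hsimple : ∀ j y, E y (simpleVec B j) =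
      E (simpleVec B j) (simpleVec B j) * M.titsForm (simpleVec B j) y := by
    intro j y
    have h1 := hinv (cs.simple j) (simpleVec B j) y
    rw [geomRep_simple, refl_simpleVec_self, refl_apply, map_neg, hEcomm, map_sub, map_smul,
      smul_eq_mul, hEcomm y] at h1
    rw [hEcomm]
    rw [hEcomm] at h1
    linarith
  have hconst : ∀ j, E (simpleVec B j) (simpleVec B j) = E (simpleVec B i) (simpleVec B i) := by
    refine hirr.forall_of_adj (a := i) rfl fun j l hj hadj => ?_
    have h1 := hsimple j (simpleVec B l)
    have h2 := hsimple l (simpleVec B j)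
    rw [hEcomm, h1, titsForm_simpleVec, titsForm_simpleVec, M.titsMatrix_comm l j] at h2
    rw [← hj]
    exact (mul_right_cancel₀ (M.titsMatrix_ne_zero_of_adj hadj) h2).symm
  set c := E (simpleVec B i) (simpleVec B i) with hc
  have hcpos : 0 < c := by
    rw [hc, hE]
    have h1 : (1 : ℝ) ≤ Q ((1 : W) : W ⧸ W') (simpleVec B i) * Q ((1 : W) : W ⧸ W')
        (simpleVec B i) := by
      rw [hQ, geomRep_one_apply, titsForm_simpleVec_self, mul_one]
    exact (zero_lt_one.trans_le h1).trans_le (Finset.single_le_sum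
      (f := fun q => Q q (simpleVec B i) * Q q (simpleVec B i))
      (fun q _ => mul_self_nonneg _) (Finset.mem_univ _))
  have hprop : ∀ y, E y = c • M.titsForm y := by
    intro y
    refine (Pi.basisFun ℝ B).ext fun j => ?_
    have := hsimple j y
    rw [hconst] at this
    simpa [M.titsForm_comm y] using this
  refine Matrix.PosSemidef.of_dotProduct_mulVec_nonneg ?_ fun x => ?_
  · ext j l
    simp [M.titsMatrix_comm j l]
  · have h1 : 0 ≤ c * M.titsForm x x := by
      rw [← smul_eq_mul, ← LinearMap.smul_apply, ← hprop, hE]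
      exact Finset.sum_nonneg fun q _ => mul_self_nonneg _
    have h2 := nonneg_of_mul_nonneg_right h1 hcpos
    rwa [titsForm, Matrix.toBilin'_apply'] at h2

end Positive

end CoxeterSystem

/-! ### Existence of a non-nested translate. -/

namespace CoxeterSystem

open CoxeterMatrix

variable {B W : Type*} [Finite B] [Group W] {M : CoxeterMatrix B} (cs : CoxeterSystem M W)

theorem exists_not_nested (hirr : M.IsIrreducible) (hpos : ¬ M.titsMatrix.PosSemidef)
    (W' : Subgroup W) [W'.Normal] [W'.FiniteIndex] (i : B) :
    ∃ w ∈ W', ¬ cs.simpleHalf i ⊆ w • cs.simpleHalf i ∧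
      ¬ w • cs.simpleHalf i ⊆ cs.simpleHalf i := by
  classical
  have := Fintype.ofFinite B
  by_contra! hcon
  have hW : ∀ w ∈ W', 1 ≤ M.titsForm (simpleVec B i) (cs.geomRep w (simpleVec B i)) := by
    intro w hw
    by_cases h : cs.simpleHalf i ⊆ w • cs.simpleHalf i
    · have := one_le_titsForm_of_subset (cs := cs) (u := 1) (v := w) (i := i) (j := i)
        (by rwa [one_smul])
      rwa [geomRep_one_apply] at this
    · have := one_le_titsForm_of_subset (cs := cs) (u := w) (v := 1) (i := i) (j := i)
        (by simpa only [one_smul] using hcon w hw h)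
      rwa [geomRep_one_apply, M.titsForm_comm] at this
  apply hpos
  by_cases h : ∃ w ∈ W', 1 < M.titsForm (simpleVec B i) (cs.geomRep w (simpleVec B i))
  · obtain ⟨w, hw, hw1⟩ := h
    exact posSemidef_of_hyperbolic hirr hW hw hw1
  · push Not at h
    exact posSemidef_of_parabolic hirr fun w hw => le_antisymm (h w hw) (hW w hw)

end CoxeterSystem

/-! ### Nilpotent groups generated by subgroups. -/

open scoped commutatorElement

namespace Subgroup

variable {G : Type*} [Group G]

theorem commutator_le_iff_le_comap_centralizer {X Y N : Subgroup G} [N.Normal] :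
    ⁅X, Y⁆ ≤ N ↔ X ≤ (centralizer (Y.map (QuotientGroup.mk' N) : Set (G ⧸ N))).comap
      (QuotientGroup.mk' N) := by
  rw [← map_le_iff_le_comap, ← commutator_eq_bot_iff_le_centralizer, ← map_commutator,
    map_eq_bot_iff, QuotientGroup.ker_mk']

theorem iSup_commutator_le {ι : Sort*} {X : ι → Subgroup G} {Y N : Subgroup G} [N.Normal]
    (h : ∀ i, ⁅X i, Y⁆ ≤ N) : ⁅⨆ i, X i, Y⁆ ≤ N :=
  commutator_le_iff_le_comap_centralizer.2
    (iSup_le fun i => commutator_le_iff_le_comap_centralizer.1 (h i))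

theorem commutator_sup_le {X Y Z N : Subgroup G} [N.Normal] (hY : ⁅X, Y⁆ ≤ N) (hZ : ⁅X, Z⁆ ≤ N) :
    ⁅X, Y ⊔ Z⁆ ≤ N := by
  rw [commutator_comm, commutator_le_iff_le_comap_centralizer] at *
  exact sup_le hY hZ

/-- The lower central series of `S`, preceded by the whole group. -/
def shiftedLowerCentralSeries (S : Subgroup G) : ℕ → Subgroup G
  | 0 => ⊤
  | n + 1 => S.lowerCentralSeries n

instance (S : Subgroup G) [S.Normal] (n : ℕ) : (S.shiftedLowerCentralSeries n).Normal := by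
  cases n
  · exact inferInstanceAs (⊤ : Subgroup G).Normal
  · exact S.lowerCentralSeries_normal _

theorem shiftedLowerCentralSeries_commutator_le (S : Subgroup G) [S.Normal] (n : ℕ) :
    ⁅S.shiftedLowerCentralSeries n, S⁆ ≤ S.shiftedLowerCentralSeries (n + 1) := by
  cases n
  · exact commutator_le_right _ _
  · exact le_rfl

/-- **Fitting's theorem**: a group generated by two normal nilpotent subgroups is nilpotent. -/
theorem isNilpotent_of_sup_eq_top {A C : Subgroup G} [A.Normal] [C.Normal]
    (hA : Group.IsNilpotent A) (hC : Group.IsNilpotent C) (h : A ⊔ C = ⊤) :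
    Group.IsNilpotent G := by
  obtain ⟨a, ha⟩ := A.isNilpotent_iff_lowerCentralSeries.1 hA
  obtain ⟨c, hc⟩ := C.isNilpotent_iff_lowerCentralSeries.1 hC
  let D : ℕ → Subgroup G := fun m => ⨆ p : {p : ℕ × ℕ // p.1 + p.2 = m},
    A.shiftedLowerCentralSeries p.1.1 ⊓ C.shiftedLowerCentralSeries p.1.2
  have hD : ∀ m, (⊤ : Subgroup G).lowerCentralSeries m ≤ D m := by
    intro m
    induction m with
    | zero => exact le_iSup_of_le ⟨(0, 0), rfl⟩ (le_inf le_rfl le_rfl)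
    | succ m ih =>
      have : (D (m + 1)).Normal := iSup_normal _
      refine (commutator_mono ih le_rfl).trans (iSup_commutator_le ?_)
      rintro ⟨⟨i, j⟩, rfl⟩
      rw [← h]
      refine commutator_sup_le ?_ ?_
      · refine le_iSup_of_le ⟨(i + 1, j), by simp only; ring⟩ (le_inf ?_ ?_)
        · exact (commutator_mono inf_le_left le_rfl).trans
            (A.shiftedLowerCentralSeries_commutator_le i)
        · exact (commutator_mono inf_le_right le_rfl).trans (commutator_le_left _ _)
      · refine le_iSup_of_le ⟨(i, j + 1), by simp only; ring⟩ (le_inf ?_ ?_)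
        · exact (commutator_mono inf_le_left le_rfl).trans (commutator_le_left _ _)
        · exact (commutator_mono inf_le_right le_rfl).trans
            (C.shiftedLowerCentralSeries_commutator_le j)
  -- If i + j = a + c + 1 then i > a or j > c; the shift by one of the series accounts for the
  -- strict inequalities.
  refine nilpotent_iff_lowerCentralSeries.2 ⟨a + c + 1, le_bot_iff.1 ((hD _).trans ?_)⟩
  refine iSup_le ?_
  rintro ⟨⟨i, j⟩, hij⟩
  simp only at hij
  by_cases hi : a + 1 ≤ i
  · obtain ⟨i, rfl⟩ : ∃ i', i = i' + 1 := ⟨i - 1, by omega⟩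
    exact inf_le_left.trans (ha ▸ A.lowerCentralSeries_antitone (by omega))
  · obtain ⟨j, rfl⟩ : ∃ j', j = j' + 1 := ⟨j - 1, by omega⟩
    exact inf_le_right.trans (hc ▸ C.lowerCentralSeries_antitone (by omega))

theorem isNilpotent_of_le {A C : Subgroup G} (h : A ≤ C) (hC : Group.IsNilpotent C) :
    Group.IsNilpotent A := by
  obtain ⟨c, hc⟩ := C.isNilpotent_iff_lowerCentralSeries.1 hC
  exact A.isNilpotent_iff_lowerCentralSeries.2 ⟨c, le_bot_iff.1 (hc ▸ lowerCentralSeries_mono c h)⟩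

theorem isNilpotent_map {G' : Type*} [Group G'] {A : Subgroup G} (f : G →* G')
    (hA : Group.IsNilpotent A) : Group.IsNilpotent (A.map f) :=
  Group.nilpotent_of_surjective (f.subgroupMap A) (f.subgroupMap_surjective A)

theorem isNilpotent_sup {A C : Subgroup G} (hA : Group.IsNilpotent A) (hC : Group.IsNilpotent C)
    (hCA : C ≤ normalizer (A : Set G)) (hAC : A ≤ normalizer (C : Set G)) :
    Group.IsNilpotent (A ⊔ C : Subgroup G) := by
  have hnA : (A.subgroupOf (A ⊔ C)).Normal :=
    normal_subgroupOf_iff_le_normalizer le_sup_left |>.2 (sup_le le_normalizer hCA)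
  have hnC : (C.subgroupOf (A ⊔ C)).Normal :=
    normal_subgroupOf_iff_le_normalizer le_sup_right |>.2 (sup_le hAC le_normalizer)
  refine isNilpotent_of_sup_eq_top (A := A.subgroupOf (A ⊔ C)) (C := C.subgroupOf (A ⊔ C))
    ((Group.isNilpotent_congr (subgroupOfEquivOfLe le_sup_left)).2 hA)
    ((Group.isNilpotent_congr (subgroupOfEquivOfLe le_sup_right)).2 hC) ?_
  rw [← subgroupOf_sup le_sup_left le_sup_right, subgroupOf_self]

theorem le_normalizer_iSup {ι : Sort*} {X : Subgroup G} {Y : ι → Subgroup G}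
    (h : ∀ i, ∀ x ∈ X, ∀ y ∈ Y i, ⁅x, y⁆ ∈ ⨆ i, Y i) :
    X ≤ normalizer ((⨆ i, Y i : Subgroup G) : Set G) := by
  rw [le_normalizer_iff_commutator_le_right]
  have hconj : ∀ x ∈ X, (⨆ i, Y i) ≤ (⨆ i, Y i).comap (MulAut.conj x).toMonoidHom := by
    intro x hx
    refine iSup_le fun i y hy => ?_
    have h1 := mul_mem (h i x hx y hy) (le_iSup Y i hy)
    simpa [commutatorElement_def] using h1
  rw [commutator_le]
  intro x hx y hy
  have h1 : x * y * x⁻¹ ∈ ⨆ i, Y i := hconj x hx hy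
  rw [commutatorElement_def]
  exact mul_mem h1 (inv_mem hy)

/-- Dropping the last or the first term of a window leaves two shorter windows, nilpotent by
induction. By the commutator condition they normalize each other, so Fitting's theorem applies. -/
theorem isNilpotent_iSup_Ico {X : ℕ → Subgroup G} (hX : ∀ k, Group.IsNilpotent (X k))
    (hcomm : ∀ k l, k < l → ⁅X k, X l⁆ ≤ ⨆ j : Set.Ioo k l, X j) (n p : ℕ) :
    Group.IsNilpotent (⨆ j : Set.Ico p (p + n), X j : Subgroup G) := by
  have hle : ∀ {s : Set ℕ} {j : ℕ}, j ∈ s → X j ≤ ⨆ j : s, X j := fun {s j} hj =>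
    le_iSup (fun j : s => X j) ⟨j, hj⟩
  have hmono : ∀ {s t : Set ℕ}, s ⊆ t → (⨆ j : s, X j) ≤ ⨆ j : t, X j := fun hst =>
    iSup_le fun j => hle (hst j.2)
  induction n using Nat.strong_induction_on generalizing p with
  | _ n ih =>
  match n with
  | 0 =>
    refine isNilpotent_of_le (C := ⊥) (iSup_le fun j => ?_) inferInstance
    exact absurd j.2 (by simp)
  | 1 =>
    refine isNilpotent_of_le (C := X p) (iSup_le fun j => ?_) (hX p)
    have := j.2
    rw [Set.mem_Ico] at this
    rw [show (j : ℕ) = p by omega]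
  | n + 2 =>
    set A := ⨆ j : Set.Ico p (p + (n + 1)), X j with hA
    set C := ⨆ j : Set.Ico (p + 1) (p + 1 + (n + 1)), X j with hC
    have hnA := ih (n + 1) (by omega) p
    have hnC := ih (n + 1) (by omega) (p + 1)
    have hlast : X (p + (n + 1)) ≤ normalizer (A : Set G) := by
      refine le_normalizer_iSup ?_
      rintro ⟨j, hj⟩ x hx y hy
      rw [Set.mem_Ico] at hj
      rw [← commutatorElement_inv]
      refine inv_mem (hmono ?_ (hcomm j (p + (n + 1)) hj.2 (commutator_mem_commutator hy hx)))
      intro l hl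
      rw [Set.mem_Ioo] at hl
      exact ⟨by omega, hl.2⟩
    have hfirst : X p ≤ normalizer (C : Set G) := by
      refine le_normalizer_iSup ?_
      rintro ⟨j, hj⟩ x hx y hy
      rw [Set.mem_Ico] at hj
      refine hmono ?_ (hcomm p j (by omega) (commutator_mem_commutator hx hy))
      intro l hl
      rw [Set.mem_Ioo] at hl
      exact ⟨by omega, by omega⟩
    have hCA : C ≤ normalizer (A : Set G) := by
      refine iSup_le ?_
      rintro ⟨j, hj⟩
      rw [Set.mem_Ico] at hj
      by_cases hjl : j = p + (n + 1)
      · exact hjl ▸ hlast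
      · exact (hA ▸ hle ⟨by omega, by omega⟩ : X j ≤ A).trans le_normalizer
    have hAC : A ≤ normalizer (C : Set G) := by
      refine iSup_le ?_
      rintro ⟨j, hj⟩
      rw [Set.mem_Ico] at hj
      by_cases hjl : j = p
      · exact hjl ▸ hfirst
      · exact (hC ▸ hle ⟨by omega, by omega⟩ : X j ≤ C).trans le_normalizer
    refine isNilpotent_of_le ?_ (isNilpotent_sup hnA hnC hCA hAC)
    refine iSup_le ?_
    rintro ⟨j, hj⟩
    rw [Set.mem_Ico] at hj
    by_cases hjl : j = p
    · exact le_sup_of_le_left (hle (j := j) ⟨by omega, by omega⟩)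
    · exact le_sup_of_le_right (hle (j := j) ⟨by omega, by omega⟩)

/-- Induction through the quotient by the center Z: there `A` becomes everything, so AZ = G, hence
`A` is normal and equals its normal closure. -/
theorem eq_top_of_normalClosure_eq_top [hG : Group.IsNilpotent G] (A : Subgroup G)
    (h : normalClosure (A : Set G) = ⊤) : A = ⊤ := by
  revert A
  refine Group.nilpotent_center_quotient_ind
    (P := fun G _ _ => ∀ A : Subgroup G, normalClosure (A : Set G) = ⊤ → A = ⊤) G ?_ ?_
  · intro G _ _ A _
    exact Subsingleton.elim _ _
  · intro G _ _ ih A h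
    have h1 : A.map (QuotientGroup.mk' (center G)) = ⊤ := by
      apply ih
      rw [coe_map, ← map_normalClosure _ _ (QuotientGroup.mk'_surjective _), h,
        map_top_of_surjective _ (QuotientGroup.mk'_surjective _)]
    have h2 : A ⊔ center G = ⊤ := by
      rw [← comap_map_eq_self (le_sup_right.trans' (QuotientGroup.ker_mk' (center G)).le :
        (QuotientGroup.mk' (center G)).ker ≤ A ⊔ center G), map_sup, h1, top_sup_eq, comap_top]
    have hA : A.Normal := by
      rw [← normalizer_eq_top_iff, eq_top_iff, ← h2]
      exact sup_le le_normalizer (center_le_normalizer _)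
    rw [← h, normalClosure_eq_self]

theorem le_of_map_conj_eq {A C : Subgroup G} {g : G} (hg : g ∈ A ⊔ C)
    (hnil : Group.IsNilpotent (A ⊔ C : Subgroup G))
    (h : A.map (MulAut.conj g).toMonoidHom = C) : C ≤ A := by
  set K := A ⊔ C with hK
  have h1 : A.subgroupOf K = ⊤ := by
    apply eq_top_of_normalClosure_eq_top
    set P := normalClosure (A.subgroupOf K : Set K) with hP
    have hAP : A.subgroupOf K ≤ P := le_normalClosure
    have hCP : C.subgroupOf K ≤ P := by
      rintro ⟨c, hcK⟩ hc
      rw [mem_subgroupOf, ← h] at hc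
      obtain ⟨a, ha, hac⟩ := hc
      have haK : a ∈ K := hK ▸ mem_sup_left ha
      have h2 : (⟨g, hg⟩ : K) * ⟨a, haK⟩ * (⟨g, hg⟩ : K)⁻¹ ∈ P :=
        normalClosure_normal.conj_mem _ (hAP (mem_subgroupOf.2 ha)) _
      have h3 : (⟨c, hcK⟩ : K) = (⟨g, hg⟩ : K) * ⟨a, haK⟩ * (⟨g, hg⟩ : K)⁻¹ :=
        Subtype.ext hac.symm
      rwa [h3]
    have h4 : A.subgroupOf K ⊔ C.subgroupOf K = ⊤ := by
      rw [← subgroupOf_sup (hK ▸ le_sup_left) (hK ▸ le_sup_right), ← hK, subgroupOf_self]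
    exact eq_top_iff.2 (h4 ▸ sup_le hAP hCP)
  exact (hK ▸ le_sup_right : C ≤ K).trans (subgroupOf_eq_top.1 h1)

theorem eq_of_map_conj_eq {A C : Subgroup G} {g : G} (hg : g ∈ A ⊔ C)
    (hnil : Group.IsNilpotent (A ⊔ C : Subgroup G))
    (h : A.map (MulAut.conj g).toMonoidHom = C) : A = C := by
  refine le_antisymm ?_ (le_of_map_conj_eq hg hnil h)
  rw [sup_comm] at hg hnil
  refine le_of_map_conj_eq (inv_mem hg) hnil ?_
  rw [← h, map_map]
  convert! A.map_id
  ext x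
  simp [mul_assoc]

end Subgroup

/-! ### Walls, prenilpotent pairs and galleries. -/

namespace CoxeterSystem

open CoxeterMatrix

variable {B W : Type*} [Group W] {M : CoxeterMatrix B} {cs : CoxeterSystem M W}

/-- A simple reflection changes only coordinate `i`, so a positive root vector that it makes
negative is a multiple of `e_i`; having norm one, it is `e_i`. -/
theorem IsRoot.eq_of_crossing [Finite B] {γ : Set W} (hγ : cs.IsRoot γ) {x : W} {i : B}
    (hx : x ∈ γ) (hxi : x * cs.simple i ∉ γ) : γ = x • cs.simpleHalf i := by
  classical
  have := Fintype.ofFinite B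
  obtain ⟨w, j, rfl⟩ := hγ
  set c := cs.geomRep (x⁻¹ * w) (simpleVec B j) with hc
  have h0 : 0 ≤ c := cs.mem_smul_simpleHalf_iff.1 hx
  have h1 : cs.geomRep (cs.simple i) c ≤ 0 := by
    have h2 : cs.geomRep ((x * cs.simple i)⁻¹ * w) (simpleVec B j) =
        cs.geomRep (cs.simple i) c := by
      rw [hc, ← geomRep_mul_apply, mul_inv_rev, inv_simple, mul_assoc]
    rw [mem_smul_simpleHalf_iff, geomRep_simpleVec_nonneg_iff, not_not] at hxi
    rw [← h2]
    exact cs.geomRep_simpleVec_nonpos hxi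
  have h3 : c = c i • simpleVec B i := by
    funext l
    by_cases hl : l = i
    · subst hl; simp
    · have := h1 l
      rw [geomRep_simple, refl_apply] at this
      simp [hl] at this
      simp [hl, le_antisymm this (h0 l)]
  have h4 : c i = 1 := by
    have h5 : M.titsForm c c = 1 := by
      rw [hc, titsForm_geomRep, titsForm_simpleVec_self]
    rw [h3] at h5
    simp only [map_smul, LinearMap.smul_apply, titsForm_simpleVec_self, smul_eq_mul, mul_one] at h5
    nlinarith [h0 i, show (0 : ℝ) ≤ c i from h0 i]
  rw [h4, one_smul] at h3
  ext y
  rw [mem_smul_simpleHalf_iff, mem_smul_simpleHalf_iff]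
  have : y⁻¹ * w = y⁻¹ * x * (x⁻¹ * w) := by group
  rw [this, geomRep_mul_apply, ← hc, h3]

theorem one_mem_simpleHalf (i : B) : (1 : W) ∈ cs.simpleHalf i := by
  simp [simpleHalf]

theorem simple_notMem_simpleHalf (i : B) : cs.simple i ∉ cs.simpleHalf i := by
  simp [simpleHalf]

theorem simple_injective [Finite B] : Function.Injective cs.simple := by
  classical
  have := Fintype.ofFinite B
  intro i j hij
  by_contra hne
  have h1 := congrFun (congrArg (fun w => cs.geomRep w (simpleVec B i)) hij) i
  simp only [geomRep_simple, refl_apply, titsForm_simpleVec_self] at h1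
  simp [Pi.single_eq_of_ne hne] at h1

theorem simple_mem_simpleHalf_of_ne [Finite B] {i j : B} (h : i ≠ j) :
    cs.simple j ∈ cs.simpleHalf i := by
  by_contra h1
  have h3 := cs.length_simple_mul (cs.simple j) i
  simp only [simpleHalf, Set.mem_ofPred_eq, not_lt, length_simple] at h1 h3
  have h4 : cs.length (cs.simple i * cs.simple j) = 0 := by omega
  rw [length_eq_zero_iff, mul_eq_one_iff_eq_inv, inv_simple] at h4
  exact h (simple_injective h4)

namespace Root

theorem ext {α β : cs.Root} (h : α.1 = β.1) : α = β := Subtype.ext h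

theorem translate_mul (v w : W) (β : cs.Root) :
    translate (v * w) β = translate v (translate w β) :=
  ext (mul_smul v w β.1)

theorem translate_one (β : cs.Root) : translate 1 β = β := ext (one_smul W β.1)

theorem translate_opp (w : W) (β : cs.Root) : translate w β.opp = (translate w β).opp :=
  ext Set.smul_set_compl

theorem opp_opp (β : cs.Root) : β.opp.opp = β := ext (compl_compl β.1)

theorem translate_simple_simpleRoot (i : B) :
    translate (cs.simple i) (cs.simpleRoot i) = (cs.simpleRoot i).opp :=
  ext (cs.compl_simpleHalf i).symm

theorem exists_eq_translate (α : cs.Root) : ∃ w i, α = translate w (cs.simpleRoot i) := by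
  obtain ⟨α, w, i, rfl⟩ := α
  exact ⟨w, i, rfl⟩

theorem mem_opp {α : cs.Root} {x : W} : x ∈ α.opp.1 ↔ x ∉ α.1 := Iff.rfl

theorem prenilpotent_opp_simpleRoot [Finite B] {i j : B} (h : i ≠ j) :
    (cs.simpleRoot i).opp.Prenilpotent (cs.simpleRoot j) := by
  refine ⟨⟨cs.simple i, simple_notMem_simpleHalf i, simple_mem_simpleHalf_of_ne h.symm⟩,
    ⟨cs.simple j, ?_, simple_notMem_simpleHalf j⟩⟩
  rw [opp_opp]
  exact simple_mem_simpleHalf_of_ne h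

/-- A root of the closed interval contains `s_i` but not `s_j`, so it separates 1 from one of them,
and that crossing determines it. -/
theorem openInterval_opp_simpleRoot [Finite B] {i j : B} (h : i ≠ j) :
    openInterval (cs.simpleRoot i).opp (cs.simpleRoot j) = ∅ := by
  rw [Set.eq_empty_iff_forall_notMem]
  rintro γ ⟨⟨h1, h2⟩, h3⟩
  have hi : cs.simple i ∈ γ.1 :=
    h1 ⟨simple_notMem_simpleHalf i, simple_mem_simpleHalf_of_ne h.symm⟩
  have hj : cs.simple j ∉ γ.1 := by
    refine h2 ⟨?_, simple_notMem_simpleHalf j⟩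
    rw [opp_opp]
    exact simple_mem_simpleHalf_of_ne h
  apply h3
  by_cases h0 : (1 : W) ∈ γ.1
  · right
    have := γ.2.eq_of_crossing h0 (by rwa [one_mul])
    exact ext (this.trans (one_smul _ _))
  · left
    have := γ.opp.2.eq_of_crossing (x := 1) (i := i) h0 (by rw [one_mul, mem_opp, not_not]; exact hi)
    rw [← opp_opp γ]
    exact congrArg opp (ext (this.trans (one_smul _ _)))

end Root

/-- A minimal gallery between two elements, with the roots containing its initial segments. -/
theorem exists_gallery (cs : CoxeterSystem M W) (i₀ : B) (x y : W) :
    ∃ (n : ℕ) (z : ℕ → W) (i : ℕ → B), z 0 = x ∧ z n = y ∧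
      (∀ k < n, z (k + 1) = z k * cs.simple (i k)) ∧
      ∀ k < n, ∀ l ≤ n, z l ∈ z k • cs.simpleHalf (i k) ↔ l ≤ k := by
  obtain ⟨ω, hred, hω⟩ := cs.exists_isReduced (x⁻¹ * y)
  have hdist : ∀ l k, l ≤ k → k ≤ ω.length →
      cs.length ((x * cs.wordProd (ω.take l))⁻¹ * (x * cs.wordProd (ω.take k))) = k - l := by
    intro l k hlk hk
    have h1 : ω.take k = ω.take l ++ (ω.take k).drop l := by
      conv_lhs => rw [← List.take_append_drop l (ω.take k)]
      rw [List.take_take, min_eq_left hlk]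
    rw [h1, wordProd_append, mul_inv_rev, mul_assoc, inv_mul_cancel_left, inv_mul_cancel_left,
      ((hred.take k).drop l).eq, List.length_drop, List.length_take, min_eq_left hk]
  have hstep : ∀ k < ω.length, x * cs.wordProd (ω.take (k + 1)) =
      x * cs.wordProd (ω.take k) * cs.simple (ω.getD k i₀) := by
    intro k hk
    rw [List.take_add_one, wordProd_append, mul_assoc, List.getElem?_eq_getElem hk,
      List.getD_eq_getElem _ _ hk]
    simp
  -- The default letter `i₀` occurs only beyond the end of the word.
  refine ⟨ω.length, fun k => x * cs.wordProd (ω.take k), fun k => ω.getD k i₀, by simp,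
    by simp [← hω], hstep, ?_⟩
  intro k hk l hl
  have e : cs.simple (ω.getD k i₀) * ((x * cs.wordProd (ω.take k))⁻¹ *
      (x * cs.wordProd (ω.take l))) = (x * cs.wordProd (ω.take (k + 1)))⁻¹ *
      (x * cs.wordProd (ω.take l)) := by
    rw [hstep k hk, mul_inv_rev _ (cs.simple _), inv_simple, mul_assoc]
  rw [Set.mem_smul_set_iff_inv_smul_mem, smul_eq_mul]
  simp only [simpleHalf, Set.mem_ofPred_eq]
  rw [e]
  constructor
  · intro h
    by_contra hlt
    rw [hdist k l (by omega) hl, hdist (k + 1) l (by omega) hl] at h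
    omega
  · intro h
    rw [← cs.length_inv, mul_inv_rev, inv_inv, hdist l k h hk.le,
      ← cs.length_inv (_ * _), mul_inv_rev, inv_inv, hdist l (k + 1) (by omega) hk]
    omega

end CoxeterSystem

/-! ### Root groups and their images modulo H. -/

namespace RootGroups

open CoxeterSystem

variable {B W : Type*} [Group W] {M : CoxeterMatrix B} {cs : CoxeterSystem M W}
  {G : Type*} [Group G] {U : cs.Root → Subgroup G}

/-- Along a minimal gallery from α ∩ β to (-α) ∩ (-β), each root of [α, β] is crossed at one step.
Ordered by these steps, the root groups satisfy the commutator condition of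
`Subgroup.isNilpotent_iSup_Ico`. -/
theorem IsTwinRootDatum.exists_isNilpotent [Finite B] (hU : IsTwinRootDatum U)
    (hnil : ∀ γ : cs.Root, Group.IsNilpotent (U γ)) {α β : cs.Root} (h : α.Prenilpotent β) :
    ∃ K : Subgroup G, Group.IsNilpotent K ∧ U α ≤ K ∧ U β ≤ K := by
  obtain ⟨⟨x, hxα, hxβ⟩, ⟨y, hyα, hyβ⟩⟩ := h
  obtain ⟨-, i₀, -⟩ := α.2
  obtain ⟨n, z, i, hz0, hzn, hstep, hmem⟩ := cs.exists_gallery i₀ x y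
  have hcross : ∀ γ ∈ Root.closedInterval α β, ∃ k < n, γ.1 = z k • cs.simpleHalf (i k) := by
    rintro γ ⟨h1, h2⟩
    have hx : z 0 ∈ γ.1 := hz0 ▸ h1 ⟨hxα, hxβ⟩
    have hy : z n ∉ γ.1 := hzn ▸ h2 ⟨hyα, hyβ⟩
    obtain ⟨k, hk, hk1, hk2⟩ : ∃ k < n, z k ∈ γ.1 ∧ z (k + 1) ∉ γ.1 := by
      by_contra! hcon
      have : ∀ k ≤ n, z k ∈ γ.1 := by
        intro k
        induction k with
        | zero => exact fun _ => hx
        | succ k ih => exact fun hk => hcon k (by omega) (ih (by omega))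
      exact hy (this n le_rfl)
    exact ⟨k, hk, γ.2.eq_of_crossing hk1 (hstep k hk ▸ hk2)⟩
  let I : ℕ → Set cs.Root := fun k =>
    {γ | γ ∈ Root.closedInterval α β ∧ k < n ∧ γ.1 = z k • cs.simpleHalf (i k)}
  -- `I k` has at most one element; `X k` is trivial when the root crossed at step `k` is outside
  -- [α, β].
  let X : ℕ → Subgroup G := fun k => ⨆ γ : I k, U γ
  have hI : ∀ k γ, γ ∈ I k → X k = U γ := by
    intro k γ hγ
    refine le_antisymm (iSup_le ?_) (le_iSup_of_le (⟨γ, hγ⟩ : I k) le_rfl)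
    rintro ⟨δ, hδ⟩
    exact (congrArg U (Root.ext (hδ.2.2.trans hγ.2.2.symm))).le
  have hX : ∀ k, Group.IsNilpotent (X k) := by
    intro k
    by_cases hk : (I k).Nonempty
    · obtain ⟨γ, hγ⟩ := hk
      rw [hI k γ hγ]
      exact hnil γ
    · have : IsEmpty (I k) := Set.isEmpty_coe_sort.2 (Set.not_nonempty_iff_eq_empty.1 hk)
      exact Subgroup.isNilpotent_of_le (C := ⊥) (iSup_of_empty _).le inferInstance
  have hcomm : ∀ k l, k < l → ⁅X k, X l⁆ ≤ ⨆ j : Set.Ioo k l, X j := by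
    intro k l hkl
    by_cases hk : (I k).Nonempty
    swap
    · have : IsEmpty (I k) := Set.isEmpty_coe_sort.2 (Set.not_nonempty_iff_eq_empty.1 hk)
      rw [show X k = ⊥ from iSup_of_empty _, Subgroup.commutator_bot_left]
      exact bot_le
    by_cases hl : (I l).Nonempty
    swap
    · have : IsEmpty (I l) := Set.isEmpty_coe_sort.2 (Set.not_nonempty_iff_eq_empty.1 hl)
      rw [show X l = ⊥ from iSup_of_empty _, Subgroup.commutator_bot_right]
      exact bot_le
    obtain ⟨γ, hγ⟩ := hk
    obtain ⟨δ, hδ⟩ := hl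
    rw [hI k γ hγ, hI l δ hδ]
    obtain ⟨⟨hγ1, hγ2⟩, hkn, hγk⟩ := hγ
    obtain ⟨⟨hδ1, hδ2⟩, hln, hδl⟩ := hδ
    have hγm : ∀ m ≤ n, z m ∈ γ.1 ↔ m ≤ k := fun m hm => by rw [hγk]; exact hmem k hkn m hm
    have hδm : ∀ m ≤ n, z m ∈ δ.1 ↔ m ≤ l := fun m hm => by rw [hδl]; exact hmem l hln m hm
    have hne : γ ≠ δ := by
      rintro rfl
      have := (hγm l hln.le).1 ((hδm l hln.le).2 le_rfl)
      omega
    refine (hU.commutator_le γ δ hne ⟨⟨x, hγ1 ⟨hxα, hxβ⟩, hδ1 ⟨hxα, hxβ⟩⟩,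
      ⟨y, hγ2 ⟨hyα, hyβ⟩, hδ2 ⟨hyα, hyβ⟩⟩⟩).trans (iSup₂_le ?_)
    rintro ε ⟨⟨hε1, hε2⟩, hεne⟩
    have hε : ε ∈ Root.closedInterval α β :=
      ⟨fun v hv => hε1 ⟨hγ1 hv, hδ1 hv⟩, fun v hv => hε2 ⟨hγ2 hv, hδ2 hv⟩⟩
    obtain ⟨m, hmn, hεm⟩ := hcross ε hε
    have hmem' : ∀ j ≤ n, z j ∈ ε.1 ↔ j ≤ m := fun j hj => by rw [hεm]; exact hmem m hmn j hj
    have hkm : k ≤ m := (hmem' k hkn.le).1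
      (hε1 ⟨(hγm k hkn.le).2 le_rfl, (hδm k hkn.le).2 hkl.le⟩)
    have hml : m ≤ l := by
      by_contra hlt
      have h1 : z (l + 1) ∉ ε.1 := hε2
        ⟨fun h => by have := (hγm (l + 1) hln).1 h; omega,
          fun h => by have := (hδm (l + 1) hln).1 h; omega⟩
      exact h1 ((hmem' (l + 1) hln).2 (by omega))
    have hmk : m ≠ k := by
      rintro rfl
      exact hεne (Or.inl (Root.ext (hεm.trans hγk.symm)))
    have hml' : m ≠ l := by
      rintro rfl
      exact hεne (Or.inr (Root.ext (hεm.trans hδl.symm)))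
    rw [← hI m ε ⟨hε, hmn, hεm⟩]
    exact le_iSup_of_le (⟨m, by omega, by omega⟩ : Set.Ioo k l) le_rfl
  refine ⟨_, Subgroup.isNilpotent_iSup_Ico hX hcomm n 0, ?_, ?_⟩
  · have hα : α ∈ Root.closedInterval α β := ⟨Set.inter_subset_left, Set.inter_subset_left⟩
    obtain ⟨k, hk, hk'⟩ := hcross α hα
    rw [← hI k α ⟨hα, hk, hk'⟩]
    exact le_iSup_of_le (⟨k, by omega, by omega⟩ : Set.Ico 0 (0 + n)) le_rfl
  · have hβ : β ∈ Root.closedInterval α β := ⟨Set.inter_subset_right, Set.inter_subset_right⟩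
    obtain ⟨k, hk, hk'⟩ := hcross β hβ
    rw [← hI k β ⟨hβ, hk, hk'⟩]
    exact le_iSup_of_le (⟨k, by omega, by omega⟩ : Set.Ico 0 (0 + n)) le_rfl

variable (U) in
/-- `n` acts on the root groups by conjugation as `w` does on the roots. -/
def LiftsTo (n : G) (w : W) : Prop :=
  ∀ β : cs.Root, (U β).map (MulAut.conj n).toMonoidHom = U (Root.translate w β)

theorem LiftsTo.mul {m n : G} {v w : W} (hm : LiftsTo U m v) (hn : LiftsTo U n w) :
    LiftsTo U (m * n) (v * w) := by
  intro β
  rw [Root.translate_mul, ← hm, ← hn, Subgroup.map_map]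
  congr 1
  ext x
  simp [mul_assoc]

theorem LiftsTo.inv {n : G} {w : W} (hn : LiftsTo U n w) : LiftsTo U n⁻¹ w⁻¹ := by
  intro β
  have h1 := hn (Root.translate w⁻¹ β)
  rw [← Root.translate_mul, mul_inv_cancel, Root.translate_one] at h1
  rw [← h1, Subgroup.map_map]
  convert! Subgroup.map_id _
  ext x
  simp [mul_assoc]

theorem liftsTo_one_of_mem_torus {t : G} (ht : t ∈ torus U) : LiftsTo U t 1 := by
  intro β
  rw [torus, Subgroup.mem_iInf] at ht
  rw [Root.translate_one]
  have hβ := Subgroup.mem_normalizer_iff.1 (ht β)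
  ext x
  constructor
  · rintro ⟨y, hy, rfl⟩
    exact (hβ y).1 hy
  · intro hx
    refine ⟨t⁻¹ * x * t, (hβ _).2 ?_, ?_⟩
    · simpa [mul_assoc] using hx
    · simp [mul_assoc]

theorem IsTwinRootDatum.exists_liftsTo_simple (hU : IsTwinRootDatum U) (i : B) :
    ∃ m ∈ weylNormalizer U, LiftsTo U m (cs.simple i) ∧
      m ∈ U (cs.simpleRoot i) ⊔ U (cs.simpleRoot i).opp := by
  obtain ⟨⟨u, hu⟩, hu1⟩ := Subgroup.ne_bot_iff_exists_ne_one.1 (hU.ne_bot (cs.simpleRoot i))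
  have hu1' : u ≠ 1 := fun h => hu1 (Subtype.ext h)
  obtain ⟨m, hm⟩ := hU.exists_weylLift i u hu hu1'
  refine ⟨m, Subgroup.mem_sup_right (Subgroup.subset_closure ⟨i, u, hu, hu1', hm⟩), hm.2, ?_⟩
  obtain ⟨u', hu', u'', hu'', rfl⟩ := hm.1
  exact mul_mem (mul_mem (Subgroup.mem_sup_right hu') (Subgroup.mem_sup_left hu))
    (Subgroup.mem_sup_right hu'')

theorem IsTwinRootDatum.exists_liftsTo (hU : IsTwinRootDatum U) (w : W) :
    ∃ n ∈ weylNormalizer U, LiftsTo U n w := by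
  induction w using cs.simple_induction_left with
  | one => exact ⟨1, one_mem _, liftsTo_one_of_mem_torus (one_mem _)⟩
  | mul_simple_left w i ih =>
    obtain ⟨n, hn, hnw⟩ := ih
    obtain ⟨m, hm, hmi, -⟩ := hU.exists_liftsTo_simple i
    exact ⟨m * n, mul_mem hm hn, hmi.mul hnw⟩

theorem IsTwinRootDatum.isNilpotent (hU : IsTwinRootDatum U)
    (hnil : ∀ i : B, Group.IsNilpotent (U (cs.simpleRoot i))) (γ : cs.Root) :
    Group.IsNilpotent (U γ) := by
  obtain ⟨w, i, rfl⟩ := γ.exists_eq_translate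
  obtain ⟨n, -, hn⟩ := hU.exists_liftsTo w
  rw [← hn]
  exact Subgroup.isNilpotent_map _ (hnil i)

/-- The subgroup of the Weyl group whose elements are induced by elements of `N ∩ H`. -/
def weylImage (U : cs.Root → Subgroup G) (H : Subgroup G) : Subgroup W where
  carrier := {w | ∃ n ∈ weylNormalizer U ⊓ H, LiftsTo U n w}
  one_mem' := ⟨1, one_mem _, liftsTo_one_of_mem_torus (one_mem _)⟩
  mul_mem' := by
    rintro v w ⟨m, hm, hmv⟩ ⟨n, hn, hnw⟩
    exact ⟨m * n, mul_mem hm hn, hmv.mul hnw⟩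
  inv_mem' := by
    rintro w ⟨n, hn, hnw⟩
    exact ⟨n⁻¹, inv_mem hn, hnw.inv⟩

theorem IsTwinRootDatum.weylImage_normal (hU : IsTwinRootDatum U) (H : Subgroup G) [H.Normal] :
    (weylImage U H).Normal := by
  refine ⟨?_⟩
  rintro w ⟨n, hn, hnw⟩ v
  obtain ⟨m, hm, hmv⟩ := hU.exists_liftsTo v
  exact ⟨m * n * m⁻¹, Subgroup.mem_inf.2 ⟨mul_mem (mul_mem hm hn.1) (inv_mem hm),
    Subgroup.Normal.conj_mem ‹_› n hn.2 m⟩, (hmv.mul hnw).mul hmv.inv⟩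

theorem IsTwinRootDatum.weylImage_finiteIndex (hU : IsTwinRootDatum U) (H : Subgroup G) [H.Normal]
    (hfin : Finite (weylNormalizer U ⧸
      (torus U ⊔ (weylNormalizer U ⊓ H)).subgroupOf (weylNormalizer U))) :
    (weylImage U H).FiniteIndex := by
  choose n hn hnw using hU.exists_liftsTo
  let f : W → weylNormalizer U ⧸
      (torus U ⊔ (weylNormalizer U ⊓ H)).subgroupOf (weylNormalizer U) :=
    fun w => QuotientGroup.mk ⟨n w, hn w⟩
  have hf : ∀ v w, f v = f w → v⁻¹ * w ∈ weylImage U H := by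
    intro v w hvw
    have h1 := QuotientGroup.eq.1 hvw
    rw [Subgroup.mem_subgroupOf] at h1
    change (n v)⁻¹ * n w ∈ torus U ⊔ (weylNormalizer U ⊓ H) at h1
    have hle : torus U ≤ weylNormalizer U := le_sup_left
    -- T normalizes N ∩ H, so their join is a product set. As `t` acts trivially on the roots, `h`
    -- lifts `v⁻¹ * w`.
    have h2 : ∃ t ∈ torus U, ∃ h ∈ weylNormalizer U ⊓ H, (n v)⁻¹ * n w = t * h := by
      have hno : torus U ≤ Subgroup.normalizer ((weylNormalizer U ⊓ H : Subgroup G) : Set G) := by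
        intro t ht
        rw [Subgroup.mem_normalizer_iff]
        intro h
        simp only [Subgroup.mem_inf]
        rw [Subgroup.Normal.mem_comm_iff ‹H.Normal› (a := t * h), inv_mul_cancel_left,
          Subgroup.mul_mem_cancel_right _ (inv_mem (hle ht)),
          Subgroup.mul_mem_cancel_left _ (hle ht)]
      rw [← SetLike.mem_coe, Subgroup.coe_mul_of_left_le_normalizer_right _ _ hno] at h1
      obtain ⟨t, ht, h, hh, e⟩ := h1
      exact ⟨t, ht, h, hh, e.symm⟩
    obtain ⟨t, ht, h, hh, e⟩ := h2
    refine ⟨h, hh, ?_⟩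
    have h3 := ((liftsTo_one_of_mem_torus ht).inv).mul ((hnw v).inv.mul (hnw w))
    rwa [e, inv_mul_cancel_left, inv_one, one_mul] at h3
  let g : W ⧸ weylImage U H → _ := fun q => f q.out
  have hg : Function.Injective g := by
    intro p q hpq
    have := hf _ _ hpq
    rw [← QuotientGroup.eq] at this
    simpa using this
  have : Finite (W ⧸ weylImage U H) := Finite.of_injective g hg
  exact Subgroup.finiteIndex_of_finite_quotient

section Quotient

variable (H : Subgroup G) [H.Normal]

theorem map_mk'_translate_eq {w : W} (hw : w ∈ weylImage U H) (β : cs.Root) :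
    (U (Root.translate w β)).map (QuotientGroup.mk' H) = (U β).map (QuotientGroup.mk' H) := by
  obtain ⟨n, hn, hnw⟩ := hw
  rw [← hnw, Subgroup.map_map]
  have hn1 : (n : G ⧸ H) = 1 := (QuotientGroup.eq_one_iff n).2 hn.2
  congr 1
  ext x
  simp [hn1]

theorem LiftsTo.map_mk' {n : G} {w : W} (h : LiftsTo U n w) (β : cs.Root) :
    ((U β).map (QuotientGroup.mk' H)).map (MulAut.conj (n : G ⧸ H)).toMonoidHom =
      (U (Root.translate w β)).map (QuotientGroup.mk' H) := by
  rw [← h, Subgroup.map_map, Subgroup.map_map]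
  congr 1

variable {H}

/-- A lift of a simple reflection lies in ⟨U_α, U_{-α}⟩, whose image is that of U_α; so the
right-hand side absorbs conjugation by all such lifts. -/
theorem IsTwinRootDatum.map_mk'_le_iSup (hU : IsTwinRootDatum U)
    (hopp : ∀ i : B, (U (cs.simpleRoot i).opp).map (QuotientGroup.mk' H) =
      (U (cs.simpleRoot i)).map (QuotientGroup.mk' H)) (β : cs.Root) :
    (U β).map (QuotientGroup.mk' H) ≤ ⨆ i : B, (U (cs.simpleRoot i)).map (QuotientGroup.mk' H) := by
  obtain ⟨w, j, rfl⟩ := β.exists_eq_translate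
  induction w using cs.simple_induction_left with
  | one =>
    rw [Root.translate_one]
    exact le_iSup (fun i : B => (U (cs.simpleRoot i)).map (QuotientGroup.mk' H)) j
  | mul_simple_left w i ih =>
    obtain ⟨m, -, hm, hmem⟩ := hU.exists_liftsTo_simple i
    rw [Root.translate_mul, ← hm.map_mk' H]
    have hm' : (m : G ⧸ H) ∈ ⨆ i : B, (U (cs.simpleRoot i)).map (QuotientGroup.mk' H) := by
      refine le_iSup (fun i : B => (U (cs.simpleRoot i)).map (QuotientGroup.mk' H)) i ?_
      have := Subgroup.mem_map_of_mem (QuotientGroup.mk' H) hmem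
      rwa [Subgroup.map_sup, hopp, sup_idem] at this
    rw [Subgroup.map_le_iff_le_comap]
    intro x hx
    exact mul_mem (mul_mem hm' (ih hx)) (inv_mem hm')

variable [Finite B]

theorem IsTwinRootDatum.map_mk'_opp_eq (hU : IsTwinRootDatum U) (hirr : M.IsIrreducible)
    (hpos : ¬ M.titsMatrix.PosSemidef)
    (hnil : ∀ i : B, Group.IsNilpotent (U (cs.simpleRoot i)))
    (hfin : Finite (weylNormalizer U ⧸
      (torus U ⊔ (weylNormalizer U ⊓ H)).subgroupOf (weylNormalizer U))) (i : B) :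
    (U (cs.simpleRoot i).opp).map (QuotientGroup.mk' H) =
      (U (cs.simpleRoot i)).map (QuotientGroup.mk' H) := by
  have := hU.weylImage_normal H
  have := hU.weylImage_finiteIndex H hfin
  obtain ⟨w, hw, h1, h2⟩ := cs.exists_not_nested hirr hpos (weylImage U H) i
  obtain ⟨x, hx, hx'⟩ := Set.not_subset.1 h1
  obtain ⟨y, hy, hy'⟩ := Set.not_subset.1 h2
  -- The two failures of inclusion are exactly prenilpotency of the pair {α, -wα}.
  obtain ⟨K, hK, hK1, hK2⟩ := hU.exists_isNilpotent (hU.isNilpotent hnil)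
    (α := cs.simpleRoot i) (β := Root.translate w (cs.simpleRoot i).opp)
    ⟨⟨x, hx, by rw [Root.translate_opp]; exact hx'⟩,
      ⟨y, hy', by rw [Root.translate_opp, Root.opp_opp]; exact hy⟩⟩
  obtain ⟨m, -, hm, hmem⟩ := hU.exists_liftsTo_simple i
  refine (Subgroup.eq_of_map_conj_eq (g := (m : G ⧸ H)) ?_ ?_ ?_).symm
  · rw [← Subgroup.map_sup]
    exact Subgroup.mem_map_of_mem (QuotientGroup.mk' H) hmem
  · refine Subgroup.isNilpotent_of_le (sup_le (Subgroup.map_mono hK1) ?_)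
      (Subgroup.isNilpotent_map (QuotientGroup.mk' H) hK)
    rw [← map_mk'_translate_eq H hw]
    exact Subgroup.map_mono hK2
  · rw [hm.map_mk' H, Root.translate_simple_simpleRoot]

/-- Modulo `H`, `x` may be replaced by an element of the opposite root group, which commutes with
`y` already in G. -/
theorem IsTwinRootDatum.commute_mk (hU : IsTwinRootDatum U)
    (hopp : ∀ i : B, (U (cs.simpleRoot i).opp).map (QuotientGroup.mk' H) =
      (U (cs.simpleRoot i)).map (QuotientGroup.mk' H)) {i j : B} (hij : i ≠ j) {x y : G}
    (hx : x ∈ U (cs.simpleRoot i)) (hy : y ∈ U (cs.simpleRoot j)) :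
    Commute (x : G ⧸ H) (y : G ⧸ H) := by
  have h1 := Subgroup.mem_map_of_mem (QuotientGroup.mk' H) hx
  rw [← hopp] at h1
  obtain ⟨x', hx', e⟩ := h1
  have hne : (cs.simpleRoot i).opp ≠ cs.simpleRoot j := by
    intro h
    have h2 : (1 : W) ∈ (cs.simpleRoot i).opp.1 := h ▸ one_mem_simpleHalf j
    exact h2 (one_mem_simpleHalf i)
  have h3 := hU.commutator_le _ _ hne (Root.prenilpotent_opp_simpleRoot hij)
  rw [Root.openInterval_opp_simpleRoot hij] at h3
  have h4 := h3 (Subgroup.commutator_mem_commutator hx' hy)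
  simp only [Set.mem_empty_iff_false, iSup_false, iSup_bot, Subgroup.mem_bot] at h4
  have h5 : Commute x' y := commutatorElement_eq_one_iff_commute.1 h4
  have e' : (x' : G ⧸ H) = x := e
  rw [← e']
  exact h5.map (QuotientGroup.mk' H)

end Quotient

end RootGroups

end

/-! ### Assembly of the homomorphism. -/

theorem mainTheorem5 {B W G : Type*} [Finite B] [Group W] [Group G] {M : CoxeterMatrix B}
    (cs : CoxeterSystem M W) (U : cs.Root → Subgroup G)
    (hU : RootGroups.IsTwinRootDatum U)
    (hirr : M.IsIrreducible) (hsph : ¬ cs.IsSpherical) (haff : ¬ cs.IsAffine)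
    (hnil : ∀ i : B, Group.IsNilpotent (U (cs.simpleRoot i)))
    (H : Subgroup G) [H.Normal]
    (hfin : Finite (RootGroups.weylNormalizer U ⧸
      (RootGroups.torus U ⊔ (RootGroups.weylNormalizer U ⊓ H)).subgroupOf
        (RootGroups.weylNormalizer U))) :
    (∃ φ : (∀ i : B, U (cs.simpleRoot i)) →*
        RootGroups.dagger U ⧸ H.subgroupOf (RootGroups.dagger U),
      Function.Surjective φ ∧
      -- `φ` is the composed map, whatever the order in which the product is taken
      ∀ l : List B, l.Nodup → (∀ i, i ∈ l) → ∀ u : (∀ i : B, U (cs.simpleRoot i)),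
        φ u = RootGroups.daggerProj U H
          (l.map fun i => RootGroups.toDagger U (cs.simpleRoot i) (u i)).prod) ∧
    Group.IsNilpotent (RootGroups.dagger U ⧸ H.subgroupOf (RootGroups.dagger U)) := by
  classical
  have := Fintype.ofFinite B
  have hpos : ¬ M.titsMatrix.PosSemidef := fun h => haff ⟨hsph, h⟩
  have hopp := hU.map_mk'_opp_eq hirr hpos hnil hfin
  set D := RootGroups.dagger U with hD
  -- Commutation and generation were proved in G/H; this embedding transfers them to G†/H†.
  let ι : D ⧸ H.subgroupOf D →* G ⧸ H := QuotientGroup.map _ _ D.subtype le_rfl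
  have hι : Function.Injective ι := by
    rw [injective_iff_map_eq_one]
    intro q hq
    induction q using QuotientGroup.induction_on with
    | H d =>
      rw [QuotientGroup.eq_one_iff]
      exact (QuotientGroup.eq_one_iff (d : G)).1 hq
  let ψ : ∀ i : B, U (cs.simpleRoot i) →* D ⧸ H.subgroupOf D := fun i =>
    (RootGroups.daggerProj U H).comp (RootGroups.toDagger U (cs.simpleRoot i))
  have hιψ : ∀ i x, ι (ψ i x) = ((x : G) : G ⧸ H) := fun i x => rfl
  have hcomm : Pairwise fun i j => ∀ x y, Commute (ψ i x) (ψ j y) := by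
    intro i j hij x y
    apply hι
    rw [map_mul, map_mul, hιψ, hιψ]
    exact hU.commute_mk hopp hij x.2 y.2
  have hsurj : Function.Surjective (MonoidHom.noncommPiCoprod ψ hcomm) := by
    rw [← MonoidHom.range_eq_top, MonoidHom.noncommPiCoprod_range, eq_top_iff,
      ← Subgroup.map_le_map_iff_of_injective hι, Subgroup.map_iSup]
    have h1 : ∀ i, (ψ i).range.map ι = (U (cs.simpleRoot i)).map (QuotientGroup.mk' H) := by
      intro i
      ext q
      constructor
      · rintro ⟨-, ⟨x, rfl⟩, rfl⟩
        exact ⟨x, x.2, rfl⟩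
      · rintro ⟨x, hx, rfl⟩
        exact ⟨_, ⟨⟨x, hx⟩, rfl⟩, rfl⟩
    simp only [h1]
    have h2 : D.map (QuotientGroup.mk' H) ≤
        ⨆ i : B, (U (cs.simpleRoot i)).map (QuotientGroup.mk' H) := by
      rw [hD, RootGroups.dagger, Subgroup.map_iSup]
      exact iSup_le fun β => hU.map_mk'_le_iSup hopp β
    rintro - ⟨q, -, rfl⟩
    induction q using QuotientGroup.induction_on with
    | H d => exact h2 ⟨d, d.2, rfl⟩
  refine ⟨⟨MonoidHom.noncommPiCoprod ψ hcomm, hsurj, ?_⟩, ?_⟩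
  · intro l hl hmem u
    have hl' : l.toFinset = Finset.univ := by
      ext i
      simp [hmem]
    rw [map_list_prod, List.map_map, MonoidHom.noncommPiCoprod_apply]
    simp only [← hl']
    exact Finset.noncommProd_toFinset l _ _ hl
  · have := hnil
    exact Group.nilpotent_of_surjective _ hsurj
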